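/- Let $m\ge 1$, $1<p<\infty$, $1/p+1/q=1$. Let $W_{m,p}=W_{m,p}[0,1]$ be the space of functions $f$ on $[0,1]$ with $f,f',\dots,f^{(m-1)}$ absolutely continuous and $f^{(m)}\in L_p[0,1]$, with norm $\big(\sum_{j<m}|f^{(j)}(0)|^p+\int_0^1|f^{(m)}|^p\big)^{1/p}$, and let $\langle\langle g,f\rangle\rangle=\sum_{j<m}g^{(j)}(0)f^{(j)}(0)+\int_0^1 f^{(m)}g^{(m)}\,dt$ for $g\in W_{m,q}$, $f\in W_{m,p}$. Let $K\ge 0$, $0=x_0\le x_1\le\dots\le x_K\le x_{K+1}=1$. Put $\chi_{\bf x}(t)=(-1)^{k-1}$ for $x_{k-1}<t<x_k$ ($1\le k\le K+1$) and $\chi_{\bf x}(x_k)=0$ for $1\le k\le K$. Consider the cone with $\ell=m$, $$V=\{f\in W_{m,p} : (-1)^{k-1}f^{(m)}(t)\ge 0\ \text{for a.e. } t\in[x_{k-1},x_k],\ k=1,\dots,K+1\},$$ and its negative polar $V^-=\{g\in W_{m,q}:\langle\langle g,f\rangle\rangle\le 0\ \forall f\in V\}$. For $g\in W_{m,q}$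 the dual projection is ${\bf P}_{\bf x}^*g=g-\tilde g$, where $\tilde g$ minimizes $\int_0^1|g^{(m)}-\tilde g^{(m)}|^q\,dt$ over all $\tilde g\in V^-$ with $\tilde g^{(j)}(0)=g^{(j)}(0)$, $0\le j<m$. The minimal value is written $\int_0^1|[{\bf P}_{\bf x}^*g]^{(m)}|^q$, with the value $+\infty$ if no such $\tilde g$ exists. Let $L_1,\dots,L_N$ be bounded linear functionals on $W_{m,p}$, $b_i(s)=L_iR(\cdot,s)$ with $$R(t,s)=R_t(s)=\sum_{j<m}\frac{t^j}{j!}\frac{s^j}{j!}+\int_0^{\min\{t,s\}}\frac{(t-u)^{m-1}(s-u)^{m-1}}{[(m-1)!]^2}\,du,$$ and $B\alpha=\sum_i\alpha_ib_i$ for $\alpha\in\mathbb R^N$. Let $\rho_i:\mathbb R\to\mathbb R$ be strictly convex and continuous with Fenchel transforms $\rho_i^*(a)=\sup_z(az-\rho_i(z))$, $y\in\mathbb R^N$, $\lambda>0$, and let the dual functional be $$\mathrm{VP}^*[\alpha;{\bf x}]=\frac{\lambda^{1-q}}{q}\int_0^1|[{\bf P}_{\bf x}^*B\alpha]^{(m)}(s)|^q\,ds+\sum_{i=1}^N\big(\rho_i^*(\alpha_i)-\alpha_iy_i\big)\in(-\infty,+\infty].$$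 Then: 1. $b_i\in W_{m,q}$ for every $i$. For $g\in W_{m,q}$ the dual projection ${\bf P}_{\bf x}^*g$ exists if and only if $g^{(j)}(0)=0$ for $0\le j<m$, and it is then unique. 2. ${\bf P}_{\bf x}^*$ is a local operator: if $g_1,g_2\in W_{m,q}$ are in its domain and $g_1^{(m)}=g_2^{(m)}$ a.e. on a set $A\subseteq[0,1]$, then $[{\bf P}_{\bf x}^*g_1]^{(m)}=[{\bf P}_{\bf x}^*g_2]^{(m)}$ a.e. on $A$. 3. ${\bf P}_{\bf x}^*B\alpha$ exists if and only if $\sum_i\alpha_ib_i^{(j)}(0)=0$ for $0\le j<m$. In that case it lies in $W_{m,q}$ and, for almost every $t$, $$[{\bf P}_{\bf x}^*B\alpha]^{(m)}(t)=D_\alpha(t):=\begin{cases}\sum_i\alpha_ib_i^{(m)}(t)&\text{if }\chi_{\bf x}(t)\sum_i\alpha_ib_i^{(m)}(t)\ge 0,\\0&\text{otherwise.}\end{cases}$$ The minimal value in the definition of ${\bf P}_{\bf x}^*B\alpha$ is then the finite number $\int_0^1|D_\alpha(t)|^q\,dt$. 4. Hence the dual problem is an explicit finite-dimensional convex minimization: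 for $\alpha$ in the linear subspace $\{\alpha\in\mathbb R^N:\sum_i\alpha_ib_i^{(j)}(0)=0,\ 0\le j<m\}$, $$\mathrm{VP}^*[\alpha;{\bf x}]=\frac{\lambda^{1-q}}{q}\int_0^1|D_\alpha(t)|^q\,dt+\sum_{i=1}^N\big(\rho_i^*(\alpha_i)-\alpha_iy_i\big),$$ and $\mathrm{VP}^*[\alpha;{\bf x}]=+\infty$ for all other $\alpha$; the function $\alpha\mapsto\mathrm{VP}^*[\alpha;{\bf x}]$ never takes the value $-\infty$ and is convex on $\mathbb R^N$ (its epigraph is convex). -/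

import Mathlib

open Set MeasureTheory
open scoped unitInterval

namespace PiecewiseConvex

noncomputable section

/-- The `j`-th derivative of a function on `[0,1]` (one-sided at the end points). The function is
extended to `ℝ` by constants, which has no influence on derivatives within `[0,1]`. -/
def D (j : ℕ) (f : I → ℝ) : ℝ → ℝ :=
  iteratedDerivWithin j (IccExtend zero_le_one f) (Icc 0 1)

/-- Lebesgue measure on `[0,1]`. -/
def leb : Measure ℝ := volume.restrict (Icc 0 1)

/-- Membership in `W_{m,p}[0,1]`: the derivatives `f, f', …, f^{(m-1)}` exist and are absolutely
continuous on `[0,1]`, and `f^{(m)}` (which then exists almost everywhere) is in `L_p[0,1]`. -/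
def MemW (m : ℕ) (p : ℝ) (f : I → ℝ) : Prop :=
  (∀ j < m, ContDiffOn ℝ j (IccExtend zero_le_one f) (Icc 0 1) ∧
    AbsolutelyContinuousOnInterval (D j f) 0 1) ∧
  MemLp (D m f) (ENNReal.ofReal p) leb

theorem IccExtend_add' (f g : I → ℝ) : IccExtend zero_le_one (f + g) =
    IccExtend zero_le_one f + IccExtend (zero_le_one (α := ℝ)) g := rfl

theorem IccExtend_smul' (c : ℝ) (f : I → ℝ) : IccExtend zero_le_one (c • f) =
    c • IccExtend (zero_le_one (α := ℝ)) f := rfl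

theorem D_smul (j : ℕ) (c : ℝ) (f : I → ℝ) : D j (c • f) = c • D j f := by
  ext t
  exact iteratedDerivWithin_const_smul_field c _

theorem D_add_of_contDiffOn {j : ℕ} {f g : I → ℝ}
    (hf : ContDiffOn ℝ j (IccExtend zero_le_one f) (Icc 0 1))
    (hg : ContDiffOn ℝ j (IccExtend zero_le_one g) (Icc 0 1)) :
    EqOn (D j (f + g)) (D j f + D j g) (Icc 0 1) := fun t ht =>
  iteratedDerivWithin_add ht (uniqueDiffOn_Icc zero_lt_one) (hf t ht) (hg t ht)

theorem ac_congr {F G : ℝ → ℝ} (hF : AbsolutelyContinuousOnInterval F 0 1)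
    (h : EqOn G F (Icc 0 1)) : AbsolutelyContinuousOnInterval G 0 1 := by
  rw [absolutelyContinuousOnInterval_iff] at hF ⊢
  intro ε hε
  obtain ⟨δ, hδ, H⟩ := hF ε hε
  refine ⟨δ, hδ, fun E hE hlt => ?_⟩
  have := H E hE hlt
  refine lt_of_eq_of_lt (Finset.sum_congr rfl fun i hi => ?_) this
  have hi' := hE.1 i hi
  rw [uIcc_of_le (zero_le_one (α := ℝ))] at hi'
  rw [h hi'.1, h hi'.2]

theorem ae_differentiable {F : ℝ → ℝ} (hF : AbsolutelyContinuousOnInterval F 0 1) :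
    ∀ᵐ t ∂leb, DifferentiableWithinAt ℝ F (Icc 0 1) t := by
  have hbv := hF.boundedVariationOn
  rw [uIcc_of_le (zero_le_one (α := ℝ))] at hbv
  have := hbv.locallyBoundedVariationOn.ae_differentiableWithinAt (measurableSet_Icc)
  exact this

theorem D_add_ae {m : ℕ} {p : ℝ} {f g : I → ℝ} (hf : MemW m p f) (hg : MemW m p g) :
    D m (f + g) =ᵐ[leb] D m f + D m g := by
  cases m with
  | zero => exact Filter.Eventually.of_forall fun t => by simp [D, IccExtend_add']
  | succ k =>
    have h1 := hf.1 k (Nat.lt_succ_self k)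
    have h2 := hg.1 k (Nat.lt_succ_self k)
    filter_upwards [ae_differentiable h1.2, ae_differentiable h2.2,
      ae_restrict_mem (measurableSet_Icc (a := (0 : ℝ)) (b := 1))] with t ht1 ht2 ht
    have e := D_add_of_contDiffOn h1.1 h2.1
    simp only [D, iteratedDerivWithin_succ, Pi.add_apply] at *
    rw [← derivWithin_add ht1 ht2]
    exact derivWithin_congr e (e ht)

/-- The Sobolev space `W_{m,p}[0,1]` as a real vector space of functions on `[0,1]`. -/
def W (m : ℕ) (p : ℝ) : Submodule ℝ (I → ℝ) where
  carrier := {f | MemW m p f}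
  zero_mem' := by
    have h0 : ∀ j, D j (0 : I → ℝ) = 0 := fun j => by
      have := D_smul j 0 0
      simpa using this
    refine ⟨fun j _ => ⟨contDiffOn_const, ?_⟩, ?_⟩
    · rw [h0]
      exact (LipschitzWith.const (0 : ℝ)).lipschitzOnWith.absolutelyContinuousOnInterval
    · rw [h0]
      exact MemLp.zero'
  add_mem' := by
    intro f g hf hg
    refine ⟨fun j hj => ⟨(hf.1 j hj).1.add (hg.1 j hj).1, ?_⟩, ?_⟩
    · exact ac_congr ((hf.1 j hj).2.add (hg.1 j hj).2)
        (D_add_of_contDiffOn (hf.1 j hj).1 (hg.1 j hj).1)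
    · exact (memLp_congr_ae (D_add_ae hf hg)).2 (hf.2.add hg.2)
  smul_mem' := by
    intro c f hf
    refine ⟨fun j hj => ⟨contDiffOn_const.smul (hf.1 j hj).1, ?_⟩, ?_⟩
    · rw [D_smul]
      exact (hf.1 j hj).2.const_mul c
    · rw [D_smul]
      exact hf.2.const_smul c

/-- The norm of `W_{m,p}`: `(∑_{j<m} |f^{(j)}(0)|^p + ∫_0^1 |f^{(m)}|^p)^{1/p}`. -/
def normW (m : ℕ) (p : ℝ) (f : I → ℝ) : ℝ :=
  (∑ j ∈ Finset.range m, |D j f 0| ^ p + ∫ t, |D m f t| ^ p ∂leb) ^ (1 / p)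

/-- Boundedness of a linear functional on `W_{m,p}`. -/
def IsBoundedFunctional {m : ℕ} {p : ℝ} (L : W m p →ₗ[ℝ] ℝ) : Prop :=
  ∃ C : ℝ, ∀ f : W m p, |L f| ≤ C * normW m p f

/-- The duality pairing `∑_{j<m} g^{(j)}(0) f^{(j)}(0) + ∫_0^1 f^{(m)} g^{(m)}` of `g ∈ W_{m,q}`
and `f ∈ W_{m,p}`. -/
def pairing (m : ℕ) (g f : I → ℝ) : ℝ :=
  ∑ j ∈ Finset.range m, D j g 0 * D j f 0 + ∫ t, D m f t * D m g t ∂leb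

/-- The kernel `R_t(s)`, for `m ≥ 1`. -/
def R (m : ℕ) (t s : I) : ℝ :=
  ∑ j ∈ Finset.range m, ((t : ℝ) ^ j / j.factorial) * ((s : ℝ) ^ j / j.factorial) +
    ∫ u in (0 : ℝ)..(min (t : ℝ) s),
      ((t : ℝ) - u) ^ (m - 1) * ((s : ℝ) - u) ^ (m - 1) / ((m - 1).factorial : ℝ) ^ 2

theorem D_eqOn {j : ℕ} {f : I → ℝ} {F : ℝ → ℝ} (h : ∀ s : I, f s = F s) :
    EqOn (D j f) (iteratedDerivWithin j F (Icc 0 1)) (Icc 0 1) := by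
  refine iteratedDerivWithin_congr fun s hs => ?_
  rw [IccExtend_of_mem _ _ hs, h]

theorem ext_eqOn {f : I → ℝ} {F : ℝ → ℝ} (h : ∀ s : I, f s = F s) :
    EqOn (IccExtend zero_le_one f) F (Icc 0 1) := fun s hs => by
  rw [IccExtend_of_mem _ _ hs, h]

instance : IsFiniteMeasure leb := by unfold leb; infer_instance

theorem memW_of_contDiff {m : ℕ} (p : ℝ) {f : I → ℝ} {F : ℝ → ℝ} (hF : ContDiff ℝ m F)
    (h : ∀ s : I, f s = F s) : MemW m p f := by
  have hu : UniqueDiffOn ℝ (Icc (0 : ℝ) 1) := uniqueDiffOn_Icc zero_lt_one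
  have key : ∀ j ≤ m, EqOn (D j f) (iteratedDeriv j F) (Icc 0 1) := fun j hj s hs => by
    rw [D_eqOn h hs]
    exact iteratedDerivWithin_eq_iteratedDeriv hu
      ((hF.of_le (by exact_mod_cast hj)).contDiffAt) hs
  refine ⟨fun j hj => ⟨?_, ?_⟩, ?_⟩
  · exact ((hF.of_le (by exact_mod_cast hj.le)).contDiffOn).congr (ext_eqOn h)
  · refine ac_congr ?_ (key j hj.le)
    refine ContDiffOn.absolutelyContinuousOnInterval ?_
    have h1 : ContDiff ℝ ((1 : ℕ) + j : ℕ) F := hF.of_le (by exact_mod_cast (by omega))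
    have h2 := ContDiff.iterate_deriv' 1 j h1
    rw [← iteratedDeriv_eq_iterate] at h2
    exact h2.contDiffOn
  · have hc : Continuous (iteratedDeriv m F) := hF.continuous_iteratedDeriv m le_rfl
    have : D m f =ᵐ[leb] iteratedDeriv m F := by
      filter_upwards [ae_restrict_mem (measurableSet_Icc (a := (0 : ℝ)) (b := 1))] with t ht
      exact key m le_rfl ht
    refine (memLp_congr_ae this).2 ?_
    obtain ⟨C, hC⟩ := isCompact_Icc.exists_bound_of_continuousOn
      (s := Icc (0 : ℝ) 1) hc.continuousOn
    refine MemLp.of_bound hc.aestronglyMeasurable C ?_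
    filter_upwards [ae_restrict_mem (measurableSet_Icc (a := (0 : ℝ)) (b := 1))] with t ht
    exact hC t ht

theorem contDiff_primitive {n : ℕ} {φ : ℝ → ℝ} (hφ : ContDiff ℝ n φ) :
    ContDiff ℝ (n + 1 : ℕ) (fun s => ∫ u in (0 : ℝ)..s, φ u) := by
  have hd : ∀ s, HasDerivAt (fun s => ∫ u in (0 : ℝ)..s, φ u) (φ s) s := fun s =>
    intervalIntegral.integral_hasDerivAt_right (hφ.continuous.intervalIntegrable _ _)
      (hφ.continuous.stronglyMeasurableAtFilter _ _) hφ.continuous.continuousAt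
  have he : deriv (fun s => ∫ u in (0 : ℝ)..s, φ u) = φ := funext fun s => (hd s).deriv
  push_cast
  rw [contDiff_succ_iff_deriv]
  refine ⟨fun s => (hd s).differentiableAt, by simp, ?_⟩
  rw [he]
  exact hφ

theorem contDiff_iteratedPrimitive (k : ℕ) : ∀ (n : ℕ) (φ : ℝ → ℝ), ContDiff ℝ n φ →
    ContDiff ℝ (n + k + 1 : ℕ)
      (fun s => ∫ u in (0 : ℝ)..s, (s - u) ^ k / (k.factorial : ℝ) * φ u) := by
  induction k with
  | zero =>
    intro n φ hφ
    simpa using contDiff_primitive hφ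
  | succ k ih =>
    intro n φ hφ
    have h1 := ih (n + 1) _ (contDiff_primitive hφ)
    have e : n + (k + 1) + 1 = n + 1 + k + 1 := by ring
    rw [e]
    convert h1 using 1
    funext s
    have hd : ∀ v, HasDerivAt (fun s => ∫ u in (0 : ℝ)..s, φ u) (φ v) v := fun s =>
      intervalIntegral.integral_hasDerivAt_right (hφ.continuous.intervalIntegrable _ _)
        (hφ.continuous.stronglyMeasurableAtFilter _ _) hφ.continuous.continuousAt
    have hp : ∀ v, HasDerivAt (fun u => (s - u) ^ (k + 1) / ((k + 1).factorial : ℝ))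
        (-((s - v) ^ k / (k.factorial : ℝ))) v := fun v => by
      have := (((hasDerivAt_id v).const_sub s).pow (k + 1)).div_const ((k + 1).factorial : ℝ)
      refine HasDerivAt.congr_deriv this ?_
      rw [Nat.factorial_succ]
      have : (k.factorial : ℝ) ≠ 0 := by positivity
      push_cast
      simp only [id]
      field_simp
    have := intervalIntegral.integral_mul_deriv_eq_deriv_mul (a := 0) (b := s)
      (fun v _ => hp v) (fun v _ => hd v)
      ((by fun_prop : Continuous fun v : ℝ =>
        -((s - v) ^ k / (k.factorial : ℝ))).intervalIntegrable _ _)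
      (hφ.continuous.intervalIntegrable _ _)
    rw [this]
    simp

/-- `R_t` belongs to `W_{m,p}` for every `p`. -/
theorem R_mem {m : ℕ} (hm : 1 ≤ m) (p : ℝ) (t : I) : R m t ∈ W m p := by
  obtain ⟨a, rfl⟩ : ∃ a, m = a + 1 := ⟨m - 1, by omega⟩
  rcases Nat.eq_zero_or_pos a with rfl | ha
  · have hval : ∀ s : I, R 1 t s = (fun s : ℝ => 1 + min (t : ℝ) s) s := fun s => by
      simp [R]
    have hlip : LipschitzWith 1 (fun s : ℝ => 1 + min (t : ℝ) s) := by
      refine LipschitzWith.of_dist_le_mul fun x y => ?_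
      simp only [Real.dist_eq, NNReal.coe_one, one_mul, add_sub_add_left_eq_sub]
      simpa using abs_min_sub_min_le_max (t : ℝ) x t y
    refine ⟨fun j hj => ?_, ?_⟩
    · obtain rfl : j = 0 := by omega
      refine ⟨?_, ?_⟩
      · exact (contDiffOn_zero.2 hlip.continuous.continuousOn).congr (ext_eqOn hval)
      · refine ac_congr hlip.lipschitzOnWith.absolutelyContinuousOnInterval ?_
        simpa [D] using ext_eqOn hval
    · have : D 1 (R 1 t) =ᵐ[leb] deriv (fun s : ℝ => 1 + min (t : ℝ) s) := by
        have hIoo : ∀ᵐ s ∂leb, s ∈ Ioo (0 : ℝ) 1 := by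
          unfold leb
          rw [← restrict_Ioo_eq_restrict_Icc]
          exact ae_restrict_mem measurableSet_Ioo
        filter_upwards [hIoo] with s hs
        rw [D_eqOn (F := fun s : ℝ => 1 + min (t : ℝ) s) hval ⟨hs.1.le, hs.2.le⟩, iteratedDerivWithin_one]
        exact derivWithin_of_mem_nhds (Icc_mem_nhds hs.1 hs.2)
      refine (memLp_congr_ae this).2 (MemLp.of_bound
        (measurable_deriv _).aestronglyMeasurable 1 (Filter.Eventually.of_forall fun s => ?_))
      simpa using norm_deriv_le_of_lipschitz hlip (x₀ := s)
  · have hφ : ContDiff ℝ (0 : ℕ) (fun u : ℝ => max ((t : ℝ) - u) 0 ^ a) :=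
      contDiff_zero.2 (by fun_prop)
    have h1 := contDiff_iteratedPrimitive a 0 _ hφ
    rw [zero_add] at h1
    have h2 : ContDiff ℝ (a + 1 : ℕ) (fun s : ℝ => ∑ j ∈ Finset.range (a + 1),
        ((t : ℝ) ^ j / j.factorial) * (s ^ j / j.factorial)) := by fun_prop
    refine memW_of_contDiff p (h2.add (contDiff_const (c := ((a.factorial : ℝ))⁻¹) |>.mul h1))
      fun s => ?_
    simp only [R, Nat.add_sub_cancel]
    congr 1
    rw [← intervalIntegral.integral_const_mul]
    have hc : Continuous fun u : ℝ => ((a.factorial : ℝ))⁻¹ *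
        (((s : ℝ) - u) ^ a / (a.factorial : ℝ) * max ((t : ℝ) - u) 0 ^ a) := by fun_prop
    rw [← intervalIntegral.integral_add_adjacent_intervals
      (hc.intervalIntegrable 0 (min (t : ℝ) s)) (hc.intervalIntegrable _ _)]
    have hz : ∫ u in (min (t : ℝ) s)..s, ((a.factorial : ℝ))⁻¹ *
        (((s : ℝ) - u) ^ a / (a.factorial : ℝ) * max ((t : ℝ) - u) 0 ^ a) = 0 := by
      refine intervalIntegral.integral_zero_ae (Filter.Eventually.of_forall fun u hu => ?_)
      rw [uIoc_of_le (min_le_right _ _)] at hu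
      have : (t : ℝ) ≤ u := by
        rcases min_lt_iff.1 hu.1 with h | h
        · exact h.le
        · exact absurd hu.2 (not_le.2 h)
      rw [max_eq_right (by linarith), zero_pow (by omega)]
      simp
    rw [hz, add_zero]
    refine intervalIntegral.integral_congr fun u hu => ?_
    rw [uIcc_of_le (le_min t.2.1 s.2.1)] at hu
    have : u ≤ t := hu.2.trans (min_le_left _ _)
    rw [max_eq_left (by linarith)]
    field_simp

/-- The representer `b(s) = L R(·,s)` of a functional `L` on `W_{m,p}`. -/
def representer {m : ℕ} (hm : 1 ≤ m) {p : ℝ} (L : W m p →ₗ[ℝ] ℝ) : I → ℝ :=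
  fun s => L ⟨R m s, R_mem hm p s⟩

/-- `Bα(t) = ∑ α_i b_i(t)`. -/
def B {N : ℕ} (b : Fin N → I → ℝ) (α : Fin N → ℝ) : I → ℝ :=
  fun t => ∑ i, α i * b i t

/-- The points `x_0 = 0, x_1, …, x_K, x_{K+1} = 1`. -/
def nodes {K : ℕ} (x : Fin K → ℝ) : Fin (K + 2) → ℝ :=
  Fin.cons 0 (Fin.snoc x 1 : Fin (K + 1) → ℝ)

/-- The cone `V^{K,m}_{m,p}[x]`: the derivative `f^{(m)}` is, almost everywhere, nonnegative on
`[x_0,x_1]`, nonpositive on `[x_1,x_2]`, and so on with alternating signs. -/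
def V {K : ℕ} (m : ℕ) (p : ℝ) (x : Fin K → ℝ) : Set (I → ℝ) :=
  {f | f ∈ W m p ∧ ∀ k : Fin (K + 1), ∀ᵐ t ∂leb,
    t ∈ Icc (nodes x k.castSucc) (nodes x k.succ) → 0 ≤ (-1 : ℝ) ^ (k : ℕ) * D m f t}

/-- The negative polar of `V^{K,m}_{m,p}[x]`, as a subset of `W_{m,q}` through the pairing. -/
def negPolar {K : ℕ} (m : ℕ) (p q : ℝ) (x : Fin K → ℝ) : Set (I → ℝ) :=
  {g | g ∈ W m q ∧ ∀ f ∈ V m p x, pairing m g f ≤ 0}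

open Classical in
/-- The sign function `χ_x`: it is `0` at the points `x_k`, and elsewhere its sign alternates from
one interval to the next, starting from `+1` left of all `x_k`. -/
def chi {K : ℕ} (x : Fin K → ℝ) (t : ℝ) : ℝ :=
  if ∃ k, x k = t then 0 else (-1) ^ (Finset.univ.filter fun k => x k < t).card

theorem chi_of_mem {K : ℕ} {x : Fin K → ℝ} (hx : Monotone x) (k : Fin (K + 1)) {t : ℝ}
    (ht : t ∈ Ioo (nodes x k.castSucc) (nodes x k.succ)) : chi x t = (-1) ^ (k : ℕ) := by
  classical
  have hlt : ∀ i : Fin K, (i : ℕ) < k → x i < t := fun i hi => by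
    obtain ⟨j, hj⟩ : ∃ j : Fin K, (k : ℕ) = j + 1 := ⟨⟨k - 1, by omega⟩, by simp; omega⟩
    have hk : k.castSucc = (j.castSucc).succ := Fin.ext (by simp [hj])
    have h1 := ht.1
    rw [hk, nodes, Fin.cons_succ, Fin.snoc_castSucc] at h1
    exact lt_of_le_of_lt (hx (show (i : ℕ) ≤ j by omega)) h1
  have hgt : ∀ i : Fin K, (k : ℕ) ≤ i → t < x i := fun i hi => by
    have hkK : (k : ℕ) < K := lt_of_le_of_lt hi i.2
    have hk : k = (⟨k, hkK⟩ : Fin K).castSucc := rfl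
    have h2 := ht.2
    rw [nodes, Fin.cons_succ, hk, Fin.snoc_castSucc] at h2
    exact lt_of_lt_of_le h2 (hx (show (k : ℕ) ≤ i from hi))
  rw [chi, if_neg]
  · congr 1
    have : (Finset.univ.filter fun i : Fin K => x i < t) =
        Finset.univ.filter fun i : Fin K => (i : ℕ) < k := by
      ext i
      simp only [Finset.mem_filter, Finset.mem_univ, true_and]
      refine ⟨fun h => ?_, hlt i⟩
      by_contra hc
      exact lt_asymm h (hgt i (not_lt.1 hc))
    rw [this, Fin.card_filter_val_lt]
    omega
  · rintro ⟨i, rfl⟩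
    rcases lt_or_ge (i : ℕ) k with h | h
    · exact lt_irrefl _ (hlt i h)
    · exact lt_irrefl _ (hgt i h)

/-- The elements of the negative polar admitted in the definition of the dual projection of `g`:
those with `g̃^{(j)}(0) = g^{(j)}(0)` for `j < m`. -/
def feasible {K : ℕ} (m : ℕ) (p q : ℝ) (x : Fin K → ℝ) (g : I → ℝ) : Set (I → ℝ) :=
  {g' | g' ∈ negPolar m p q x ∧ ∀ j < m, D j g' 0 = D j g 0}

/-- `h = P_x^* g`: `h = g - g̃` where `g̃` attains the infimum of `∫ |g^{(m)} - g̃^{(m)}|^q` over the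
admitted `g̃`. -/
def IsDualProjection {K : ℕ} (m : ℕ) (p q : ℝ) (x : Fin K → ℝ) (g h : I → ℝ) : Prop :=
  ∃ g' ∈ feasible m p q x g, h = g - g' ∧
    IsMinOn (fun g'' : I → ℝ => ∫ t, |D m g t - D m g'' t| ^ q ∂leb) (feasible m p q x g) g'

/-- The quantity `∫ |[P_x^* g]^{(m)}|^q`, as the infimum that defines it (`+∞` if no `g̃` is
admitted). -/
def dualEnergy {K : ℕ} (m : ℕ) (p q : ℝ) (x : Fin K → ℝ) (g : I → ℝ) : EReal :=
  ⨅ g' ∈ feasible m p q x g, ((∫ t, |D m g t - D m g' t| ^ q ∂leb : ℝ) : EReal)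

/-- The Fenchel/Legendre transform. -/
def fenchelConj (ρ : ℝ → ℝ) (a : ℝ) : EReal := ⨆ z : ℝ, ((a * z - ρ z : ℝ) : EReal)

/-- The dual functional `VP^*[α; x]`. -/
def dualFunctional {K N : ℕ} (m : ℕ) (p q lam : ℝ) (x : Fin K → ℝ) (b : Fin N → I → ℝ)
    (ρ : Fin N → ℝ → ℝ) (y : Fin N → ℝ) (α : Fin N → ℝ) : EReal :=
  ((lam ^ (1 - q) / q : ℝ) : EReal) * dualEnergy m p q x (B b α) +
    ∑ i, (fenchelConj (ρ i) (α i) - ((α i * y i : ℝ) : EReal))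

/-- The explicit `m`-th derivative `∑ α_i b_i^{(m)}(t)` where `χ_x(t) ∑ α_i b_i^{(m)}(t) ≥ 0`, and
zero elsewhere. -/
def explicitDeriv {K N : ℕ} (m : ℕ) (x : Fin K → ℝ) (b : Fin N → I → ℝ) (α : Fin N → ℝ)
    (t : ℝ) : ℝ :=
  if 0 ≤ chi x t * ∑ i, α i * D m (b i) t then ∑ i, α i * D m (b i) t else 0

end

end PiecewiseConvex

open PiecewiseConvex

namespace PiecewiseConvex

noncomputable section

/-! The proof reduces the constrained minimization to a separate scalar problem at almost every `t`.
Integrating `m` times from `0` (`lift`) realizes every `L_p` function as an `m`-th derivative with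
zero initial values, and an element of `W m p` is determined by its initial values and its `m`-th
derivative (`eq_zero_of_D`). Hence there are enough test functions to compute the polar cone. The
monomials of degree `< m` and their negatives lie in `V`, so initial values of polar elements
vanish; lifting `χ_x` restricted to the set where `χ_x g^{(m)} > 0` forces `χ_x g^{(m)} ≤ 0`
(`mem_negPolar_iff`).

Admissible `g̃` therefore exist only if `g` has zero initial values. The problem is then to
approximate `v = g^{(m)}` by `w` with `χ_x w ≤ 0`. For almost every `t` the distance `|v - w|` is
least exactly when `v - w` is the part of `v` whose sign agrees with `χ_x` (`signPart`). Existence,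
uniqueness, locality and the explicit formula all follow from `isDualProjection_iff`.

That the representers lie in `W m q` is a duality statement: `lift` carries the `L_p` norm to the
norm of `W m p`, so a bounded functional gives an element of the dual of `L_p`, hence a density in
`L_q` by the Riesz theorem. By Cauchy's formula for repeated integration, the representer is a
polynomial plus the lift of this density (`representer_mem`).

For convexity, `|signPart x v|` is almost everywhere the positive part of `χ_x v`, so its `q`-th
power is convex in `v`. Real upper bounds for the Fenchel conjugates turn the epigraph into a system
of real inequalities stable under convex combinations (`dualFunctional_le_iff`). -/

/-! ### Iterated primitives and Cauchy's formula -/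

/-- The `k`-fold iterated primitive of `u`, based at `0`. -/
def iterInt : ℕ → (ℝ → ℝ) → ℝ → ℝ
  | 0, u => u
  | k + 1, u => fun s => ∫ t in (0 : ℝ)..s, iterInt k u t

theorem iterInt_succ (k : ℕ) (u : ℝ → ℝ) (s : ℝ) :
    iterInt (k + 1) u s = ∫ t in (0 : ℝ)..s, iterInt k u t := rfl

theorem iterInt_succ_zero (k : ℕ) (u : ℝ → ℝ) : iterInt (k + 1) u 0 = 0 := by
  simp [iterInt]

/-- The definition adds integrations on the outside; this form isolates the innermost one, the only
one that acts on a merely integrable function. -/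
theorem iterInt_succ' (k : ℕ) (u : ℝ → ℝ) : iterInt (k + 1) u = iterInt k (iterInt 1 u) := by
  induction k with
  | zero => rfl
  | succ k ih => rw [iterInt, ih]; rfl

theorem continuous_iterInt_one {u : ℝ → ℝ} (hu : Integrable u) : Continuous (iterInt 1 u) :=
  intervalIntegral.continuous_primitive (fun _ _ => hu.intervalIntegrable) 0

theorem contDiff_iterInt {u : ℝ → ℝ} (hu : Integrable u) (k : ℕ) :
    ContDiff ℝ k (iterInt (k + 1) u) := by
  induction k with
  | zero => exact contDiff_zero.2 (continuous_iterInt_one hu)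
  | succ k ih => exact contDiff_primitive ih

theorem iterInt_add {u v : ℝ → ℝ} (hu : Integrable u) (hv : Integrable v) (k : ℕ) :
    iterInt k (u + v) = iterInt k u + iterInt k v := by
  have h1 : iterInt 1 (u + v) = iterInt 1 u + iterInt 1 v := funext fun s =>
    intervalIntegral.integral_add hu.intervalIntegrable hv.intervalIntegrable
  induction k with
  | zero => rfl
  | succ k ih =>
    cases k with
    | zero => exact h1
    | succ k =>
      funext s
      rw [iterInt_succ, ih]
      exact intervalIntegral.integral_add
        ((contDiff_iterInt hu k).continuous.intervalIntegrable _ _)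
        ((contDiff_iterInt hv k).continuous.intervalIntegrable _ _)

theorem iterInt_smul (c : ℝ) (u : ℝ → ℝ) (k : ℕ) : iterInt k (c • u) = c • iterInt k u := by
  induction k with
  | zero => rfl
  | succ k ih =>
    funext s
    rw [iterInt_succ, ih]
    exact intervalIntegral.integral_smul c _

/-- One integration is needed to forget null sets: equality is everywhere for `k + 1`, but would
fail for zero integrations. -/
theorem iterInt_succ_congr {u v : ℝ → ℝ} (h : u =ᵐ[volume] v) (k : ℕ) :
    iterInt (k + 1) u = iterInt (k + 1) v := by
  rw [iterInt_succ', iterInt_succ' k v]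
  congr 1
  funext s
  exact intervalIntegral.integral_congr_ae (h.mono fun _ ht _ => ht)

theorem deriv_iterInt {u : ℝ → ℝ} (hu : Integrable u) (k : ℕ) :
    deriv (iterInt (k + 2) u) = iterInt (k + 1) u := by
  have hc := (contDiff_iterInt hu k).continuous
  funext s
  exact (intervalIntegral.integral_hasDerivAt_right (hc.intervalIntegrable _ _)
    (hc.stronglyMeasurableAtFilter _ _) hc.continuousAt).deriv

theorem iteratedDeriv_iterInt {u : ℝ → ℝ} (hu : Integrable u) (k j : ℕ) :
    iteratedDeriv j (iterInt (k + j + 1) u) = iterInt (k + 1) u := by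
  induction j with
  | zero => simp
  | succ j ih =>
    rw [iteratedDeriv_succ', show k + (j + 1) + 1 = (k + j) + 2 by ring, deriv_iterInt hu, ih]

theorem ae_hasDerivAt_iterInt_one {u : ℝ → ℝ} (hu : Integrable u) :
    ∀ᵐ s, HasDerivAt (iterInt 1 u) (u s) s := by
  filter_upwards [LocallyIntegrable.ae_hasDerivAt_integral hu.locallyIntegrable] with s hs using hs 0

/-- Cauchy's formula for repeated integration. -/
theorem iterInt_eq_integral {u : ℝ → ℝ} (hu : Integrable u) (k : ℕ) (s : ℝ) :
    iterInt (k + 1) u s = ∫ t in (0 : ℝ)..s, (s - t) ^ k / (k.factorial : ℝ) * u t := by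
  induction k generalizing u with
  | zero => simp [iterInt]
  | succ k ih =>
    -- The induction hypothesis needs integrability on all of `ℝ`, which a primitive of `u` may
    -- lack. Cutting it off outside `[0, s]` does not affect the iterated primitives there.
    have hloc : iterInt (k + 1 + 1) u s =
        iterInt (k + 1) ((uIcc 0 s).indicator (iterInt 1 u)) s := by
      rw [iterInt_succ']
      have key : ∀ j, EqOn (iterInt j (iterInt 1 u))
          (iterInt j ((uIcc 0 s).indicator (iterInt 1 u))) (uIcc 0 s) := by
        intro j
        induction j with
        | zero => exact fun t ht => by simp [iterInt, indicator_of_mem ht]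
        | succ j hj =>
          exact fun t ht => intervalIntegral.integral_congr fun v hv =>
            hj (uIcc_subset_uIcc left_mem_uIcc ht hv)
      exact key _ right_mem_uIcc
    have hc := continuous_iterInt_one hu
    rw [hloc, ih ((integrable_indicator_iff measurableSet_uIcc).2
      (hc.continuousOn.integrableOn_compact isCompact_uIcc))]
    have hp : ∀ v, HasDerivAt (fun t => (s - t) ^ (k + 1) / ((k + 1).factorial : ℝ))
        (-((s - v) ^ k / (k.factorial : ℝ))) v := fun v => by
      have := (((hasDerivAt_id v).const_sub s).pow (k + 1)).div_const ((k + 1).factorial : ℝ)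
      refine HasDerivAt.congr_deriv this ?_
      rw [Nat.factorial_succ]
      have : (k.factorial : ℝ) ≠ 0 := by positivity
      push_cast
      simp only [id]
      field_simp
    have hac : AbsolutelyContinuousOnInterval
        (fun t => (s - t) ^ (k + 1) / ((k + 1).factorial : ℝ)) 0 s :=
      ContDiffOn.absolutelyContinuousOnInterval
        (by fun_prop : ContDiff ℝ 1 fun t : ℝ =>
          (s - t) ^ (k + 1) / ((k + 1).factorial : ℝ)).contDiffOn
    have hac' : AbsolutelyContinuousOnInterval (iterInt 1 u) 0 s :=
      hu.intervalIntegrable.absolutelyContinuousOnInterval_intervalIntegral left_mem_uIcc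
    -- Since `u` is only integrable, parts are taken for absolutely continuous functions. Both
    -- boundary terms vanish: the power at `s`, the primitive at `0`.
    have hparts := hac.integral_mul_deriv_eq_deriv_mul hac'
    have e1 : ∫ t in (0 : ℝ)..s, (s - t) ^ (k + 1) / ((k + 1).factorial : ℝ) * u t =
        ∫ t in (0 : ℝ)..s, (s - t) ^ (k + 1) / ((k + 1).factorial : ℝ) *
          deriv (iterInt 1 u) t := by
      refine intervalIntegral.integral_congr_ae ?_
      filter_upwards [ae_hasDerivAt_iterInt_one hu] with t ht _
      rw [ht.deriv]
    rw [e1, hparts, iterInt_succ_zero]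
    have e2 : ∀ t, deriv (fun t => (s - t) ^ (k + 1) / ((k + 1).factorial : ℝ)) t =
        -((s - t) ^ k / (k.factorial : ℝ)) := fun t => (hp t).deriv
    simp only [e2, sub_self, ne_eq, Nat.succ_ne_zero, not_false_eq_true, zero_pow, zero_div,
      zero_mul, mul_zero, zero_sub, neg_mul, intervalIntegral.integral_neg, neg_neg]
    refine intervalIntegral.integral_congr fun t ht => ?_
    simp only [indicator_of_mem ht]

/-! ### Functions with prescribed `m`-th derivative -/

theorem leb_ae_iff {P : ℝ → Prop} :
    (∀ᵐ t ∂leb, P t) ↔ ∀ᵐ t, t ∈ Icc (0 : ℝ) 1 → P t :=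
  ae_restrict_iff' measurableSet_Icc

theorem ae_leb_mem_Ioo : ∀ᵐ t ∂leb, t ∈ Ioo (0 : ℝ) 1 := by
  unfold leb
  rw [← restrict_Ioo_eq_restrict_Icc]
  exact ae_restrict_mem measurableSet_Ioo

/-- The extension of a function on `[0,1]` by zero. -/
def zeroExt (u : ℝ → ℝ) : ℝ → ℝ := (Icc 0 1).indicator u

theorem integrable_zeroExt {u : ℝ → ℝ} (hu : Integrable u leb) : Integrable (zeroExt u) :=
  (integrable_indicator_iff measurableSet_Icc).2 hu

theorem zeroExt_congr {u v : ℝ → ℝ} (h : u =ᵐ[leb] v) : zeroExt u =ᵐ[volume] zeroExt v := by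
  filter_upwards [leb_ae_iff.1 h] with t ht
  by_cases h' : t ∈ Icc (0 : ℝ) 1
  · simp [zeroExt, indicator_of_mem h', ht h']
  · simp [zeroExt, indicator_of_notMem h']

/-- The function on `[0,1]` with `m`-th derivative `u` and vanishing derivatives of order `< m`
at `0`. -/
def lift (m : ℕ) (u : ℝ → ℝ) : I → ℝ := fun s => iterInt m (zeroExt u) s

theorem lift_add {m : ℕ} {u v : ℝ → ℝ} (hu : Integrable u leb) (hv : Integrable v leb) :
    lift m (u + v) = lift m u + lift m v := by
  have : zeroExt (u + v) = zeroExt u + zeroExt v := indicator_add' _ _ _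
  funext s
  rw [lift, this, iterInt_add (integrable_zeroExt hu) (integrable_zeroExt hv)]
  rfl

theorem lift_smul {m : ℕ} (c : ℝ) (u : ℝ → ℝ) : lift m (c • u) = c • lift m u := by
  funext s
  have : zeroExt (c • u) = c • zeroExt u := indicator_const_smul (Icc 0 1) c u
  rw [lift, this, iterInt_smul]
  rfl

theorem lift_congr {m : ℕ} (hm : 1 ≤ m) {u v : ℝ → ℝ} (h : u =ᵐ[leb] v) :
    lift m u = lift m v := by
  obtain ⟨k, rfl⟩ : ∃ k, m = k + 1 := ⟨m - 1, by omega⟩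
  funext s
  rw [lift, lift, iterInt_succ_congr (zeroExt_congr h)]

theorem lift_eq_integral {k : ℕ} {u : ℝ → ℝ} (hu : Integrable u leb) (s : I) :
    lift (k + 1) u s = ∫ t in (0 : ℝ)..s, ((s : ℝ) - t) ^ k / (k.factorial : ℝ) * u t := by
  rw [lift, iterInt_eq_integral (integrable_zeroExt hu)]
  refine intervalIntegral.integral_congr fun t ht => ?_
  rw [uIcc_of_le s.2.1] at ht
  simp only [zeroExt, indicator_of_mem (show t ∈ Icc (0 : ℝ) 1 from ⟨ht.1, ht.2.trans s.2.2⟩)]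

/-- Writing the order as `k + j + 1` leaves at least one integration after `j` derivatives, so the
identity holds at every point, in particular at `0`. -/
theorem D_lift {k j : ℕ} {u : ℝ → ℝ} (hu : Integrable u leb) :
    EqOn (D j (lift (k + j + 1) u)) (iterInt (k + 1) (zeroExt u)) (Icc 0 1) := fun t ht => by
  rw [D_eqOn (f := lift (k + j + 1) u) (F := iterInt (k + j + 1) (zeroExt u)) (fun _ => rfl) ht,
    iteratedDerivWithin_eq_iteratedDeriv (uniqueDiffOn_Icc zero_lt_one) _ ht,
    iteratedDeriv_iterInt (integrable_zeroExt hu)]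
  exact ((contDiff_iterInt (integrable_zeroExt hu) (k + j)).of_le
    (by exact_mod_cast Nat.le_add_left j k)).contDiffAt

theorem D_lift_zero {m j : ℕ} (hj : j < m) {u : ℝ → ℝ} (hu : Integrable u leb) :
    D j (lift m u) 0 = 0 := by
  obtain ⟨k, rfl⟩ : ∃ k, m = k + j + 1 := ⟨m - 1 - j, by omega⟩
  rw [D_lift hu (left_mem_Icc.2 zero_le_one), iterInt_succ_zero]

theorem D_succ_ae (j : ℕ) (f : I → ℝ) : D (j + 1) f =ᵐ[leb] deriv (D j f) := by
  filter_upwards [ae_leb_mem_Ioo] with t ht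
  rw [D, iteratedDerivWithin_succ]
  exact derivWithin_of_mem_nhds (Icc_mem_nhds ht.1 ht.2)

theorem D_lift_ae {m : ℕ} (hm : 1 ≤ m) {u : ℝ → ℝ} (hu : Integrable u leb) :
    D m (lift m u) =ᵐ[leb] u := by
  obtain ⟨k, rfl⟩ : ∃ k, m = k + 1 := ⟨m - 1, by omega⟩
  have h0 : EqOn (D k (lift (k + 1) u)) (iterInt 1 (zeroExt u)) (Icc 0 1) := by
    have := D_lift (k := 0) (j := k) hu
    rwa [zero_add] at this
  filter_upwards [D_succ_ae k (lift (k + 1) u), ae_leb_mem_Ioo,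
    leb_ae_iff.2 ((ae_hasDerivAt_iterInt_one (integrable_zeroExt hu)).mono fun t h _ => h)]
    with t h1 ht h2
  have he : D k (lift (k + 1) u) =ᶠ[nhds t] iterInt 1 (zeroExt u) :=
    h0.eventuallyEq_of_mem (Icc_mem_nhds ht.1 ht.2)
  rw [h1, he.deriv_eq, h2.deriv, zeroExt, indicator_of_mem (Ioo_subset_Icc_self ht)]

theorem integrable_of_memLp {p : ℝ} (hp : 1 ≤ p) {u : ℝ → ℝ}
    (hu : MemLp u (ENNReal.ofReal p) leb) : Integrable u leb :=
  hu.integrable (by simpa using hp)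

theorem lift_mem {m : ℕ} (hm : 1 ≤ m) {p : ℝ} (hp : 1 ≤ p) {u : ℝ → ℝ}
    (hu : MemLp u (ENNReal.ofReal p) leb) : lift m u ∈ W m p := by
  have hi := integrable_of_memLp hp hu
  refine ⟨fun j hj => ?_, (memLp_congr_ae (D_lift_ae hm hi)).2 hu⟩
  obtain ⟨k, rfl⟩ : ∃ k, m = k + j + 1 := ⟨m - 1 - j, by omega⟩
  refine ⟨?_, ac_congr ?_ (D_lift hi)⟩
  · exact ((contDiff_iterInt (integrable_zeroExt hi) (k + j)).of_le
      (by exact_mod_cast Nat.le_add_left j k)).contDiffOn.congr (ext_eqOn fun _ => rfl)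
  · have hii : IntervalIntegrable (iterInt k (zeroExt u)) volume 0 1 := by
      cases k with
      | zero => exact (integrable_zeroExt hi).intervalIntegrable
      | succ k =>
        exact (contDiff_iterInt (integrable_zeroExt hi) k).continuous.intervalIntegrable _ _
    exact hii.absolutelyContinuousOnInterval_intervalIntegral left_mem_uIcc

/-- An absolutely continuous function is the integral of its almost everywhere derivative. -/
theorem D_eq_zero_of_ae {j : ℕ} {f : I → ℝ} (hac : AbsolutelyContinuousOnInterval (D j f) 0 1)
    (h0 : D j f 0 = 0) (hd : D (j + 1) f =ᵐ[leb] 0) : EqOn (D j f) 0 (Icc 0 1) := by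
  intro t ht
  have hsub : uIcc 0 t ⊆ uIcc (0 : ℝ) 1 := by
    rw [uIcc_of_le ht.1, uIcc_of_le zero_le_one]
    exact Icc_subset_Icc_right ht.2
  have h := (hac.mono hsub).integral_deriv_eq_sub
  rw [h0, sub_zero] at h
  rw [← h]
  refine intervalIntegral.integral_zero_ae ?_
  filter_upwards [leb_ae_iff.1 hd, leb_ae_iff.1 (D_succ_ae j f)] with s h1 h2 hs
  rw [uIoc_of_le ht.1] at hs
  have hs' : s ∈ Icc (0 : ℝ) 1 := ⟨hs.1.le, hs.2.trans ht.2⟩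
  rw [← h2 hs', h1 hs']
  rfl

/-- A function in `W_{m,p}` is determined by its derivatives at `0` and its `m`-th derivative. -/
theorem eq_zero_of_D {m : ℕ} (hm : 1 ≤ m) {p : ℝ} {f : I → ℝ} (hf : f ∈ W m p)
    (h0 : ∀ j < m, D j f 0 = 0) (hd : D m f =ᵐ[leb] 0) : f = 0 := by
  -- Descending induction on the order `j`, from `m - 1` to `0`; the index `i` counts the distance
  -- to `m - 1`.
  have key : ∀ i, ∀ j < m, m = i + j + 1 → EqOn (D j f) 0 (Icc 0 1) := by
    intro i
    induction i with
    | zero =>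
      intro j hj h
      refine D_eq_zero_of_ae (hf.1 j hj).2 (h0 j hj) ?_
      rwa [show j + 1 = m by omega]
    | succ i ih =>
      intro j hj h
      refine D_eq_zero_of_ae (hf.1 j hj).2 (h0 j hj) ?_
      filter_upwards [ae_leb_mem_Ioo] with t ht
      exact ih (j + 1) (by omega) (by omega) ⟨ht.1.le, ht.2.le⟩
  funext s
  have := key (m - 1) 0 hm (by omega) s.2
  simpa [D, IccExtend_of_mem _ _ s.2] using this

/-! ### Taylor monomials -/

/-- The normalized monomial `t^j / j!` on `[0,1]`. -/
def mono (j : ℕ) : I → ℝ := fun t => (t : ℝ) ^ j / j.factorial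

theorem mono_mem (m : ℕ) (p : ℝ) (j : ℕ) : mono j ∈ W m p :=
  memW_of_contDiff (F := fun t : ℝ => t ^ j / j.factorial) p (by fun_prop) fun _ => rfl

theorem D_mono (i j : ℕ) : EqOn (D i (mono j))
    (fun t => (j.descFactorial i : ℝ) * t ^ (j - i) / j.factorial) (Icc 0 1) := fun t ht => by
  rw [D_eqOn (f := mono j) (F := fun t : ℝ => t ^ j / j.factorial) (fun _ => rfl) ht,
    iteratedDerivWithin_eq_iteratedDeriv (uniqueDiffOn_Icc zero_lt_one)
      ((by fun_prop : ContDiff ℝ i fun t : ℝ => t ^ j / (j.factorial : ℝ)).contDiffAt) ht]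
  simp only [div_eq_mul_inv]
  have := iteratedDeriv_pow (𝕜 := ℝ) (x := t) j i
  rw [show (fun t : ℝ => t ^ j * (j.factorial : ℝ)⁻¹) = fun t => (j.factorial : ℝ)⁻¹ * t ^ j from
    funext fun t => mul_comm _ _, iteratedDeriv_const_mul_field]
  rw [mul_comm]
  congr 1

theorem D_mono_of_lt {i j : ℕ} (h : j < i) : EqOn (D i (mono j)) 0 (Icc 0 1) := fun t ht => by
  rw [D_mono i j ht, Nat.descFactorial_of_lt h]
  simp

theorem D_mono_zero (i j : ℕ) : D i (mono j) 0 = if i = j then 1 else 0 := by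
  rcases lt_trichotomy i j with h | rfl | h
  · rw [D_mono i j (left_mem_Icc.2 zero_le_one), if_neg h.ne]
    simp [Nat.sub_ne_zero_of_lt h]
  · rw [D_mono i i (left_mem_Icc.2 zero_le_one), if_pos rfl]
    simp only [Nat.descFactorial_self, Nat.sub_self, pow_zero, mul_one]
    exact div_self (by positivity)
  · rw [D_mono_of_lt h (left_mem_Icc.2 zero_le_one), if_neg h.ne']
    rfl

/-! ### The dual of `L_p` over a finite measure space -/

section Riesz

open Filter
open scoped ENNReal Topology

variable {α : Type*} [MeasurableSpace α] {μ : Measure α}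

theorem indicatorConstLp_eq_smul {P : ℝ≥0∞} {E : Set α} (hE : MeasurableSet E) (hμE : μ E ≠ ∞)
    (c : ℝ) : indicatorConstLp P hE hμE c = c • indicatorConstLp P hE hμE (1 : ℝ) := by
  rw [indicatorConstLp, indicatorConstLp, ← MemLp.toLp_const_smul]
  congr 1
  funext a
  by_cases ha : a ∈ E <;> simp [ha]

variable [IsFiniteMeasure μ]

/-- The signed measure `E ↦ Λ 1_E` of a bounded functional on `L_p` over a finite measure space. -/
theorem exists_signedMeasure_of_dual_Lp {P : ℝ≥0∞} [hP : Fact (1 ≤ P)] (hPt : P ≠ ∞)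
    (Λ : Lp ℝ P μ →L[ℝ] ℝ) :
    ∃ ν : SignedMeasure α, ∀ (E : Set α) (hE : MeasurableSet E),
      ν E = Λ (indicatorConstLp P hE (measure_ne_top μ E) 1) := by
  classical
  refine ⟨{ measureOf' := fun E => if hE : MeasurableSet E then
              Λ (indicatorConstLp P hE (measure_ne_top μ E) 1) else 0
            empty' := ?_
            not_measurable' := fun E hE => dif_neg hE
            m_iUnion' := ?_ }, fun E hE => dif_pos hE⟩
  · rw [dif_pos MeasurableSet.empty, indicatorConstLp_empty, map_zero]
  · intro f hf hd
    rw [dif_pos (MeasurableSet.iUnion hf)]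
    have hfin : ∀ s : Finset ℕ, MeasurableSet (⋃ i ∈ s, f i) := fun s =>
      s.measurableSet_biUnion fun i _ => hf i
    have hsum : ∀ s : Finset ℕ, (∑ i ∈ s, if hE : MeasurableSet (f i) then
        Λ (indicatorConstLp P hE (measure_ne_top μ (f i)) 1) else 0) =
        Λ (indicatorConstLp P (hfin s) (measure_ne_top μ _) 1) := by
      intro s
      induction s using Finset.induction_on with
      | empty => simp
      | insert a s ha ih =>
        rw [Finset.sum_insert ha, ih, dif_pos (hf a), ← map_add]
        congr 1
        rw [← indicatorConstLp_disjoint_union]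
        · congr 1
          simp
        · rw [Set.disjoint_iUnion₂_right]
          exact fun i hi => hd fun h => ha (h ▸ hi)
    rw [HasSum, SummationFilter.unconditional_filter]
    simp only [hsum]
    -- Countable additivity is continuity of `Λ` along indicators of finite unions. They converge in
    -- `L_p`, `P < ∞`, because the measure of the remaining set tends to `0`.
    refine (Λ.continuous.tendsto _).comp (tendsto_indicatorConstLp_set hPt ?_)
    have hmono : Monotone fun s : Finset ℕ => ⋃ i ∈ s, f i := fun s t hst =>
      Set.biUnion_subset_biUnion_left hst
    have hU : ⋃ s : Finset ℕ, ⋃ i ∈ s, f i = ⋃ i, f i := by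
      exact (Set.iUnion_eq_iUnion_finset f).symm
    have h1 := tendsto_measure_iUnion_atTop (μ := μ) hmono
    rw [hU] at h1
    have h2 := ENNReal.Tendsto.sub (tendsto_const_nhds (x := μ (⋃ i, f i))) h1
      (Or.inl (measure_ne_top _ _))
    rw [tsub_self] at h2
    refine h2.congr fun s => ?_
    have hs : (⋃ i ∈ s, f i) ⊆ ⋃ i, f i := Set.iUnion₂_subset_iUnion _ _
    rw [Set.symmDiff_def, Set.sdiff_eq_empty.2 hs, Set.empty_union,
      measure_sdiff hs (hfin s).nullMeasurableSet (measure_ne_top _ _)]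
    rfl

/-- Radon–Nikodym: a null set has zero indicator in `L_p`, so the signed measure is absolutely
continuous. -/
theorem exists_density_of_dual_Lp {P : ℝ≥0∞} [hP : Fact (1 ≤ P)] (hPt : P ≠ ∞)
    (Λ : Lp ℝ P μ →L[ℝ] ℝ) :
    ∃ G : α → ℝ, Measurable G ∧ Integrable G μ ∧ ∀ (E : Set α) (hE : MeasurableSet E),
      Λ (indicatorConstLp P hE (measure_ne_top μ E) 1) = ∫ a in E, G a ∂μ := by
  obtain ⟨ν, hν⟩ := exists_signedMeasure_of_dual_Lp hPt Λ
  have hac : ν ≪ᵥ μ.toENNRealVectorMeasure := by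
    refine VectorMeasure.AbsolutelyContinuous.mk fun E hE h0 => ?_
    rw [Measure.toENNRealVectorMeasure_apply_measurable hE] at h0
    rw [hν E hE]
    have : indicatorConstLp P hE (measure_ne_top μ E) (1 : ℝ) = 0 := by
      rw [← norm_eq_zero, norm_indicatorConstLp (zero_lt_one.trans_le hP.1).ne' hPt,
        Measure.real, h0]
      have : P.toReal ≠ 0 := (ENNReal.toReal_pos (zero_lt_one.trans_le hP.1).ne' hPt).ne'
      simp [this]
    rw [this, map_zero]
  have hd := (SignedMeasure.absolutelyContinuous_iff_withDensityᵥ_rnDeriv_eq ν μ).1 hac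
  refine ⟨ν.rnDeriv μ, SignedMeasure.measurable_rnDeriv _ _,
    SignedMeasure.integrable_rnDeriv _ _, fun E hE => ?_⟩
  rw [← hν E hE, ← withDensityᵥ_apply (SignedMeasure.integrable_rnDeriv _ _) hE, hd]

theorem dual_Lp_simpleFunc {P : ℝ≥0∞} [hP : Fact (1 ≤ P)]
    {Λ : Lp ℝ P μ →L[ℝ] ℝ} {G : α → ℝ} (hG : Integrable G μ)
    (h : ∀ (E : Set α) (hE : MeasurableSet E),
      Λ (indicatorConstLp P hE (measure_ne_top μ E) 1) = ∫ a in E, G a ∂μ)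
    (φ : SimpleFunc α ℝ) (hφ : MemLp φ P μ) : Λ (hφ.toLp φ) = ∫ a, φ a * G a ∂μ := by
  have hint : ∀ φ : SimpleFunc α ℝ, Integrable (fun a => φ a * G a) μ := fun φ => by
    obtain ⟨C, hC⟩ := φ.exists_forall_norm_le
    exact hG.bdd_mul φ.aestronglyMeasurable (ae_of_all _ hC)
  induction φ using SimpleFunc.induction with
  | const c hE =>
    rename_i E
    have e : hφ.toLp _ = c • indicatorConstLp P hE (measure_ne_top μ E) (1 : ℝ) := by
      rw [← indicatorConstLp_eq_smul, indicatorConstLp]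
      congr 1
    rw [e, map_smul, h E hE, smul_eq_mul, ← integral_const_mul, ← integral_indicator hE]
    refine integral_congr_ae (ae_of_all _ fun a => ?_)
    by_cases ha : a ∈ E <;> simp [ha]
  | @add f g hd hf hg =>
    have mf := f.memLp_of_isFiniteMeasure P μ
    have mg := g.memLp_of_isFiniteMeasure P μ
    have e : hφ.toLp _ = mf.toLp f + mg.toLp g := (MemLp.toLp_add mf mg)
    rw [e, map_add, hf mf, hg mg, ← integral_add (hint f) (hint g)]
    simp [add_mul]

/-- For simple `0 ≤ φ ≤ |G|`, testing `Λ` on `sgn(G) φ^{q-1}` gives `A ≤ ‖Λ‖ A^{1/p}` with `A = ∫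
φ^q`, hence `A ≤ ‖Λ‖^q`. Monotone convergence along `φ ↑ |G|` finishes. -/
theorem memLp_density {p q : ℝ} (hpq : p.HolderConjugate q) [Fact (1 ≤ ENNReal.ofReal p)]
    {Λ : Lp ℝ (ENNReal.ofReal p) μ →L[ℝ] ℝ} {G : α → ℝ} (hGm : Measurable G)
    (hG : Integrable G μ) (h : ∀ (E : Set α) (hE : MeasurableSet E),
      Λ (indicatorConstLp (ENNReal.ofReal p) hE (measure_ne_top μ E) 1) = ∫ a in E, G a ∂μ) :
    MemLp G (ENNReal.ofReal q) μ := by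
  have hp := hpq.pos
  have hq := hpq.symm.pos
  have hq1 := hpq.symm.lt
  let F : α → ℝ≥0∞ := fun a => ‖G a‖ₑ
  have hFm : Measurable F := hGm.enorm
  let φ : ℕ → SimpleFunc α ℝ := fun n => (SimpleFunc.eapprox F n).map ENNReal.toReal
  have hφ0 : ∀ n a, 0 ≤ φ n a := fun n a => ENNReal.toReal_nonneg
  have hφle : ∀ n a, φ n a ≤ |G a| := fun n a => by
    have h1 : SimpleFunc.eapprox F n a ≤ F a := by
      rw [← SimpleFunc.iSup_eapprox_apply hFm a]
      exact le_iSup (fun n => SimpleFunc.eapprox F n a) n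
    have := ENNReal.toReal_mono (by simp [F]) h1
    simpa [F, φ] using this
  have hbound : ∀ n, ∫ a, φ n a ^ q ∂μ ≤ ‖Λ‖ ^ q := by
    intro n
    let sgn : SimpleFunc α ℝ := SimpleFunc.piecewise {a | 0 ≤ G a}
      (measurableSet_le measurable_const hGm) (SimpleFunc.const α 1) (SimpleFunc.const α (-1))
    -- The exponent makes `|u|^p = φ^q`, as `(q - 1) p = q`, while `u G = φ^{q-1} |G| ≥ φ^q`.
    let u : SimpleFunc α ℝ := sgn * (φ n).map fun z => z ^ (q - 1)
    have hsgn : ∀ a, sgn a * G a = |G a| := fun a => by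
      by_cases ha : 0 ≤ G a
      · simp [sgn, SimpleFunc.piecewise_apply, ha, abs_of_nonneg]
      · simp [sgn, SimpleFunc.piecewise_apply, ha, abs_of_neg (not_le.1 ha)]
    have hsgn' : ∀ a, |sgn a| = 1 := fun a => by
      by_cases ha : 0 ≤ G a <;> simp [sgn, SimpleFunc.piecewise_apply, ha]
    have hu : MemLp u (ENNReal.ofReal p) μ := u.memLp_of_isFiniteMeasure _ μ
    have hφint : Integrable (fun a => φ n a ^ q) μ :=
      ((φ n).map fun z => z ^ q).integrable_of_isFiniteMeasure
    have huG : Integrable (fun a => u a * G a) μ := by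
      obtain ⟨C, hC⟩ := u.exists_forall_norm_le
      exact hG.bdd_mul u.aestronglyMeasurable (ae_of_all _ hC)
    have h1 : ∫ a, φ n a ^ q ∂μ ≤ ∫ a, u a * G a ∂μ := by
      refine integral_mono hφint huG fun a => ?_
      have e1 : u a * G a = φ n a ^ (q - 1) * |G a| := by
        rw [← hsgn a]
        simp only [u, SimpleFunc.coe_mul, Pi.mul_apply, SimpleFunc.map_apply]
        ring
      have e2 : φ n a ^ q = φ n a ^ (q - 1) * φ n a := by
        nth_rewrite 3 [← Real.rpow_one (φ n a)]
        rw [← Real.rpow_add_of_nonneg (hφ0 n a) (by linarith) zero_le_one, sub_add_cancel]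
      show φ n a ^ q ≤ u a * G a
      rw [e1, e2]
      exact mul_le_mul_of_nonneg_left (hφle n a) (Real.rpow_nonneg (hφ0 n a) _)
    have hnorm : ‖hu.toLp u‖ = (∫ a, φ n a ^ q ∂μ) ^ (1 / p) := by
      rw [Lp.norm_toLp, hu.eLpNorm_eq_integral_rpow_norm (by simpa using hp)
        ENNReal.ofReal_ne_top, ENNReal.toReal_ofReal (by positivity), ENNReal.toReal_ofReal hp.le,
        one_div]
      congr 1
      refine integral_congr_ae (ae_of_all _ fun a => ?_)
      have : ‖u a‖ = φ n a ^ (q - 1) := by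
        simp only [u, SimpleFunc.coe_mul, Pi.mul_apply, SimpleFunc.map_apply, norm_mul,
          Real.norm_eq_abs, hsgn', one_mul]
        exact abs_of_nonneg (Real.rpow_nonneg (hφ0 n a) _)
      simp only [this]
      rw [← Real.rpow_mul (hφ0 n a), hpq.symm.sub_one_mul_conj]
    have h2 := (le_abs_self _).trans (Λ.le_opNorm (hu.toLp u))
    rw [dual_Lp_simpleFunc hG h u hu, hnorm] at h2
    set A := ∫ a, φ n a ^ q ∂μ with hA
    have hA0 : 0 ≤ A := integral_nonneg fun a => Real.rpow_nonneg (hφ0 n a) _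
    have h3 : A ≤ ‖Λ‖ * A ^ (1 / p) := h1.trans h2
    rcases hA0.eq_or_lt with h0 | h0
    · rw [← h0]
      positivity
    · have e : A = A ^ (1 / q) * A ^ (1 / p) := by
        rw [← Real.rpow_add h0, one_div, one_div, hpq.symm.inv_add_inv_eq_one, Real.rpow_one]
      have h4 : A ^ (1 / q) ≤ ‖Λ‖ := by
        rw [e] at h3
        exact le_of_mul_le_mul_right (by rwa [← e] at h3 ⊢) (Real.rpow_pos_of_pos h0 (1 / p))
      calc A = (A ^ (1 / q)) ^ q := by
            rw [← Real.rpow_mul hA0, one_div_mul_cancel hq.ne', Real.rpow_one]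
        _ ≤ ‖Λ‖ ^ q := Real.rpow_le_rpow (by positivity) h4 hq.le
  have hlim : Tendsto (fun n => ∫⁻ a, SimpleFunc.eapprox F n a ^ q ∂μ) atTop
      (𝓝 (∫⁻ a, F a ^ q ∂μ)) := by
    refine lintegral_tendsto_of_tendsto_of_monotone
      (fun n => ((SimpleFunc.eapprox F n).measurable.pow_const q).aemeasurable)
      (ae_of_all _ fun a n k hnk =>
        ENNReal.rpow_le_rpow (SimpleFunc.monotone_eapprox F hnk a) hq.le)
      (ae_of_all _ fun a => ?_)
    refine (ENNReal.continuous_rpow_const.tendsto _).comp ?_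
    rw [← SimpleFunc.iSup_eapprox_apply hFm a]
    exact tendsto_atTop_iSup fun n k hnk => SimpleFunc.monotone_eapprox F hnk a
  have hle : ∫⁻ a, F a ^ q ∂μ ≤ ENNReal.ofReal (‖Λ‖ ^ q) := by
    refine le_of_tendsto' hlim fun n => ?_
    have e : ∀ a, SimpleFunc.eapprox F n a ^ q = ENNReal.ofReal (φ n a ^ q) := fun a => by
      rw [← ENNReal.ofReal_rpow_of_nonneg (hφ0 n a) hq.le]
      simp only [φ, SimpleFunc.map_apply]
      rw [ENNReal.ofReal_toReal (SimpleFunc.eapprox_lt_top F n a).ne]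
    simp only [e]
    rw [← ofReal_integral_eq_lintegral_ofReal (f := fun a => φ n a ^ q)
      ((φ n).map fun z => z ^ q).integrable_of_isFiniteMeasure
      (ae_of_all _ fun a => Real.rpow_nonneg (hφ0 n a) _)]
    exact ENNReal.ofReal_le_ofReal (hbound n)
  refine ⟨hGm.aestronglyMeasurable, ?_⟩
  rw [eLpNorm_lt_top_iff_lintegral_rpow_enorm_lt_top (by simpa using hq) ENNReal.ofReal_ne_top,
    ENNReal.toReal_ofReal hq.le]
  exact hle.trans_lt ENNReal.ofReal_lt_top

/-- **Riesz representation** of the dual of `L_p` over a finite measure space, `1 < p < ∞`. -/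
theorem exists_memLp_of_dual_Lp {p q : ℝ} (hpq : p.HolderConjugate q)
    [Fact (1 ≤ ENNReal.ofReal p)] (Λ : Lp ℝ (ENNReal.ofReal p) μ →L[ℝ] ℝ) :
    ∃ G : α → ℝ, MemLp G (ENNReal.ofReal q) μ ∧
      ∀ u : Lp ℝ (ENNReal.ofReal p) μ, Λ u = ∫ a, u a * G a ∂μ := by
  obtain ⟨G, hGm, hG, h⟩ := exists_density_of_dual_Lp ENNReal.ofReal_ne_top Λ
  have hGq := memLp_density hpq hGm hG h
  refine ⟨G, hGq, fun u => ?_⟩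
  have : ENNReal.HolderConjugate (ENNReal.ofReal p) (ENNReal.ofReal q) := hpq.ennrealOfReal
  have : Fact (1 ≤ ENNReal.ofReal q) := ⟨by simpa using hpq.symm.lt.le⟩
  -- By Hölder, integration against `G` is continuous on `L_p`, so it need only be compared with `Λ`
  -- on indicators.
  let Γ : Lp ℝ (ENNReal.ofReal p) μ →L[ℝ] ℝ :=
    ((ContinuousLinearMap.mul ℝ ℝ).lpPairing μ (ENNReal.ofReal p) (ENNReal.ofReal q)).flip
      (hGq.toLp G)
  have hΓ : ∀ u : Lp ℝ (ENNReal.ofReal p) μ, Γ u = ∫ a, u a * G a ∂μ := fun u => by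
    simp only [Γ, ContinuousLinearMap.flip_apply, ContinuousLinearMap.lpPairing_eq_integral,
      ContinuousLinearMap.mul_apply']
    refine integral_congr_ae ?_
    filter_upwards [hGq.coeFn_toLp] with a ha
    rw [ha]
  rw [← hΓ]
  refine Lp.induction ENNReal.ofReal_ne_top (fun u => Λ u = Γ u) ?_ ?_
    (isClosed_eq Λ.continuous Γ.continuous) u
  · intro c E hE hμE
    rw [Lp.simpleFunc.coe_indicatorConst]
    have e : indicatorConstLp (ENNReal.ofReal p) hE hμE.ne c =
        c • indicatorConstLp (ENNReal.ofReal p) hE hμE.ne (1 : ℝ) :=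
      indicatorConstLp_eq_smul hE hμE.ne c
    rw [e, map_smul, map_smul, h E hE, hΓ, ← integral_indicator hE]
    congr 1
    refine integral_congr_ae ?_
    filter_upwards [indicatorConstLp_coeFn (p := ENNReal.ofReal p) (hs := hE)
      (hμs := hμE.ne) (c := (1 : ℝ))] with a ha
    rw [ha]
    by_cases h' : a ∈ E <;> simp [h']
  · intro f g hf hg _ h1 h2
    rw [map_add, map_add, h1, h2]

end Riesz

/-! ### Representers of bounded functionals -/

/-- Taylor's kernel: the `m`-th derivative of `R_s` for `m = k + 1`. -/
def taylorKernel (k : ℕ) (s : ℝ) : ℝ → ℝ :=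
  (Iic s).indicator fun u => (s - u) ^ k / (k.factorial : ℝ)

theorem memLp_taylorKernel (k : ℕ) (s : ℝ) (P : ENNReal) : MemLp (taylorKernel k s) P leb := by
  have hc : Continuous fun u : ℝ => (s - u) ^ k / (k.factorial : ℝ) := by fun_prop
  obtain ⟨C, hC⟩ := isCompact_Icc.exists_bound_of_continuousOn
    (s := Icc (0 : ℝ) 1) hc.continuousOn
  refine MemLp.of_bound (hc.measurable.indicator measurableSet_Iic).aestronglyMeasurable C ?_
  filter_upwards [ae_restrict_mem (measurableSet_Icc (a := (0 : ℝ)) (b := 1))] with t ht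
  exact (norm_indicator_le_norm_self _ _).trans (hC t ht)

/-- Cauchy's formula for the lift has upper limit `t`; the cut-off at `s` in the kernel turns it
into `min t s`. -/
theorem R_eq_sum_add_lift (k : ℕ) (s : I) : R (k + 1) s =
    ∑ j ∈ Finset.range (k + 1), ((s : ℝ) ^ j / j.factorial) • mono j +
      lift (k + 1) (taylorKernel k s) := by
  funext t
  rw [Pi.add_apply, lift_eq_integral ((memLp_taylorKernel k s 1).integrable le_rfl), R,
    Finset.sum_apply]
  congr 1
  rw [intervalIntegral.integral_of_le t.2.1, intervalIntegral.integral_of_le (le_min s.2.1 t.2.1)]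
  have e : ∀ u : ℝ, ((t : ℝ) - u) ^ k / (k.factorial : ℝ) * taylorKernel k s u =
      (Iic (s : ℝ)).indicator (fun u => ((s : ℝ) - u) ^ (k + 1 - 1) * ((t : ℝ) - u) ^ (k + 1 - 1) /
        ((k + 1 - 1).factorial : ℝ) ^ 2) u := fun u => by
    by_cases hu : u ∈ Iic (s : ℝ)
    · simp only [taylorKernel, indicator_of_mem hu, Nat.add_sub_cancel]
      field_simp
    · simp [taylorKernel, indicator_of_notMem hu]
  simp only [e]
  rw [setIntegral_indicator measurableSet_Iic, Ioc_inter_Iic, min_comm]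

/-- Cauchy's formula again, now as a function of `s`: this makes the density of a functional the
`m`-th derivative of its representer. -/
theorem integral_taylorKernel_mul {k : ℕ} {G : ℝ → ℝ} (hG : Integrable G leb) (s : I) :
    ∫ u, taylorKernel k s u * G u ∂leb = lift (k + 1) G s := by
  rw [lift_eq_integral hG, intervalIntegral.integral_of_le s.2.1, ← integral_Icc_eq_integral_Ioc]
  have e : ∀ u : ℝ, taylorKernel k s u * G u =
      (Iic (s : ℝ)).indicator (fun u => ((s : ℝ) - u) ^ k / (k.factorial : ℝ) * G u) u :=
    fun u => by
      by_cases hu : u ∈ Iic (s : ℝ)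
      · simp only [taylorKernel, indicator_of_mem hu]
      · simp [taylorKernel, indicator_of_notMem hu]
  have hI : Icc 0 1 ∩ Iic (s : ℝ) = Icc 0 (s : ℝ) := Set.ext fun u =>
    ⟨fun h => ⟨h.1.1, h.2⟩, fun h => ⟨⟨h.1, h.2.trans s.2.2⟩, h.2⟩⟩
  simp only [e, leb]
  rw [setIntegral_indicator measurableSet_Iic, hI]

/-- Since `lift` preserves the norm, a bounded functional on `W m p` restricts to a bounded
functional on `L_p`. -/
theorem normW_lift {m : ℕ} (hm : 1 ≤ m) {p : ℝ} (hp : 1 ≤ p) {u : ℝ → ℝ}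
    (hu : MemLp u (ENNReal.ofReal p) leb) :
    normW m p (lift m u) = (eLpNorm u (ENNReal.ofReal p) leb).toReal := by
  have hi := integrable_of_memLp hp hu
  have hp0 : 0 < p := by linarith
  rw [hu.eLpNorm_eq_integral_rpow_norm (by simpa using hp0) ENNReal.ofReal_ne_top,
    ENNReal.toReal_ofReal (by positivity), ENNReal.toReal_ofReal hp0.le, normW, one_div]
  congr 1
  rw [Finset.sum_eq_zero fun j hj => ?_, zero_add]
  · refine integral_congr_ae ?_
    filter_upwards [D_lift_ae hm hi] with t ht
    rw [ht, Real.norm_eq_abs]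
  · rw [D_lift_zero (Finset.mem_range.1 hj) hi, abs_zero, Real.zero_rpow hp0.ne']

theorem exists_density_of_functional {m : ℕ} (hm : 1 ≤ m) {p q : ℝ} (hpq : p.HolderConjugate q)
    {L : W m p →ₗ[ℝ] ℝ} (hL : IsBoundedFunctional L) :
    ∃ G : ℝ → ℝ, MemLp G (ENNReal.ofReal q) leb ∧
      ∀ (u : ℝ → ℝ) (hu : MemLp u (ENNReal.ofReal p) leb),
        L ⟨lift m u, lift_mem hm hpq.lt.le hu⟩ = ∫ t, u t * G t ∂leb := by
  obtain ⟨C, hC⟩ := hL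
  have hp : 1 ≤ p := hpq.lt.le
  have : Fact (1 ≤ ENNReal.ofReal p) := ⟨by simpa using hp⟩
  have hint : ∀ u : Lp ℝ (ENNReal.ofReal p) leb, Integrable u leb := fun u =>
    integrable_of_memLp hp (Lp.memLp u)
  -- Sums and multiples in `Lp` match those of representatives only almost everywhere; `lift` does
  -- not see the difference.
  let Λ₀ : Lp ℝ (ENNReal.ofReal p) leb →ₗ[ℝ] ℝ :=
    { toFun := fun u => L ⟨lift m u, lift_mem hm hp (Lp.memLp u)⟩
      map_add' := fun u v => by
        rw [← map_add]
        congr 1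
        apply Subtype.ext
        show lift m _ = lift m _ + lift m _
        rw [lift_congr hm (Lp.coeFn_add u v), lift_add (hint u) (hint v)]
      map_smul' := fun c u => by
        rw [RingHom.id_apply, ← map_smul]
        congr 1
        apply Subtype.ext
        show lift m _ = c • lift m _
        rw [lift_congr hm (Lp.coeFn_smul c u), lift_smul] }
  obtain ⟨G, hG, h⟩ := exists_memLp_of_dual_Lp hpq (Λ₀.mkContinuous C fun u => by
    rw [Lp.norm_def, ← normW_lift hm hp (Lp.memLp u)]
    exact hC ⟨lift m u, _⟩)
  refine ⟨G, hG, fun u hu => ?_⟩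
  have e := h (hu.toLp u)
  have e1 : lift m (hu.toLp u) = lift m u := lift_congr hm hu.coeFn_toLp
  have e2 : ∫ t, hu.toLp u t * G t ∂leb = ∫ t, u t * G t ∂leb := by
    refine integral_congr_ae ?_
    filter_upwards [hu.coeFn_toLp] with t ht
    rw [ht]
  rw [e2] at e
  rw [← e]
  show L _ = L _
  congr 1
  exact Subtype.ext e1.symm

/-- The representer of a bounded functional on `W_{m,p}` belongs to `W_{m,q}`. -/
theorem representer_mem {m : ℕ} (hm : 1 ≤ m) {p q : ℝ} (hpq : p.HolderConjugate q)
    {L : W m p →ₗ[ℝ] ℝ} (hL : IsBoundedFunctional L) : representer hm L ∈ W m q := by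
  obtain ⟨k, rfl⟩ : ∃ k, m = k + 1 := ⟨m - 1, by omega⟩
  obtain ⟨G, hG, h⟩ := exists_density_of_functional hm hpq hL
  have hq : 1 ≤ q := hpq.symm.lt.le
  -- Taylor expansion of the representer: its initial values are the numbers `L (t^j / j!)` and its
  -- `m`-th derivative is `G`.
  have e : representer hm L = ∑ j ∈ Finset.range (k + 1),
      L ⟨mono j, mono_mem (k + 1) p j⟩ • mono j + lift (k + 1) G := by
    funext s
    have e1 : (⟨R (k + 1) s, R_mem hm p s⟩ : W (k + 1) p) =
        ∑ j ∈ Finset.range (k + 1), ((s : ℝ) ^ j / j.factorial) •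
          (⟨mono j, mono_mem (k + 1) p j⟩ : W (k + 1) p) +
        ⟨lift (k + 1) (taylorKernel k s), lift_mem hm hpq.lt.le (memLp_taylorKernel k s _)⟩ := by
      apply Subtype.ext
      simpa using R_eq_sum_add_lift k s
    rw [representer, e1, map_add, map_sum,
      h _ (memLp_taylorKernel k s _), integral_taylorKernel_mul (integrable_of_memLp hq hG),
      Pi.add_apply, Finset.sum_apply]
    congr 1
    refine Finset.sum_congr rfl fun j _ => ?_
    rw [map_smul, Pi.smul_apply, smul_eq_mul, smul_eq_mul, mul_comm, mono]
  rw [e]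
  exact (W (k + 1) q).add_mem
    ((W (k + 1) q).sum_mem fun j _ => (W (k + 1) q).smul_mem _ (mono_mem _ _ _))
    (lift_mem hm hq hG)

/-! ### The sign function, the cone and its polar -/

theorem ae_leb_not_node {K : ℕ} (x : Fin K → ℝ) : ∀ᵐ t ∂leb, ∀ k, x k ≠ t := by
  have hn : NullSingletonClass leb := by unfold leb; infer_instance
  refine ae_all_iff.2 fun k => ?_
  filter_upwards [compl_mem_ae_iff.2 (measure_singleton (μ := leb) (x k))] with t ht h
  exact ht h.symm

theorem chi_eq_or {K : ℕ} {x : Fin K → ℝ} {t : ℝ} (h : ∀ k, x k ≠ t) :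
    chi x t = 1 ∨ chi x t = -1 := by
  rw [chi, if_neg (not_exists.2 h)]
  exact neg_one_pow_eq_or ℝ _

theorem measurable_chi {K : ℕ} (x : Fin K → ℝ) : Measurable (chi x) := by
  classical
  -- The power of `-1` becomes a finite product of step functions, which is visibly measurable.
  have h : chi x = fun t => if ∃ k, x k = t then 0 else ∏ k, if x k < t then (-1 : ℝ) else 1 := by
    funext t
    rw [chi, Finset.prod_ite]
    simp
  rw [h]
  refine Measurable.ite ?_ measurable_const ?_
  · exact (Set.finite_range x).measurableSet
  · exact Finset.measurable_fun_prod _ fun k _ =>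
      Measurable.ite measurableSet_Ioi measurable_const measurable_const

/-- If `t` were in no gap, `nodes x i < t` would pass from each node to the next, ending with `1 <
t`. -/
theorem exists_mem_Ioo_nodes {K : ℕ} {x : Fin K → ℝ} {t : ℝ} (ht : t ∈ Ioo (0 : ℝ) 1)
    (h : ∀ k, x k ≠ t) : ∃ k : Fin (K + 1), t ∈ Ioo (nodes x k.castSucc) (nodes x k.succ) := by
  by_contra! hc
  have hne : ∀ i, nodes x i ≠ t := by
    intro i
    refine Fin.cases ?_ (fun i => ?_) i
    · exact ht.1.ne
    · refine Fin.lastCases ?_ (fun i => ?_) i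
      · simpa [nodes] using ht.2.ne'
      · simpa [nodes] using h i
  have hlt : ∀ i, nodes x i < t := by
    intro i
    induction i using Fin.induction with
    | zero => exact ht.1
    | succ i ih =>
      refine lt_of_le_of_ne ?_ (hne _)
      by_contra hi
      exact hc i ⟨ih, not_le.1 hi⟩
  have h1 := hlt (Fin.last K).succ
  rw [nodes, Fin.cons_succ, Fin.snoc_last] at h1
  exact lt_asymm h1 ht.2

/-- Nodes form a null set, so the conditions on the separate intervals merge into one sign condition
with `chi`. -/
theorem mem_V_iff {K m : ℕ} {p : ℝ} {x : Fin K → ℝ} (hx : Monotone x) {f : I → ℝ} :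
    f ∈ V m p x ↔ f ∈ W m p ∧ ∀ᵐ t ∂leb, 0 ≤ chi x t * D m f t := by
  refine and_congr_right fun _ => ⟨fun h => ?_, fun h k => ?_⟩
  · filter_upwards [ae_all_iff.2 h, ae_leb_mem_Ioo, ae_leb_not_node x] with t h1 h2 h3
    obtain ⟨k, hk⟩ := exists_mem_Ioo_nodes h2 h3
    rw [chi_of_mem hx k hk]
    exact h1 k (Ioo_subset_Icc_self hk)
  · filter_upwards [h, ae_leb_not_node (nodes x)] with t h1 h2 ht
    rwa [← chi_of_mem hx k ⟨lt_of_le_of_ne ht.1 (h2 _), lt_of_le_of_ne ht.2 (h2 _).symm⟩]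

theorem D_sub_of_mem {m j : ℕ} (hj : j < m) {q : ℝ} {f g : I → ℝ} (hf : f ∈ W m q)
    (hg : g ∈ W m q) : D j (f - g) 0 = D j f 0 - D j g 0 := by
  rw [sub_eq_add_neg, ← neg_one_smul ℝ g, D_add_of_contDiffOn (hf.1 j hj).1
    (((W m q).smul_mem (-1) hg).1 j hj).1 (left_mem_Icc.2 zero_le_one), Pi.add_apply, D_smul]
  simp [sub_eq_add_neg]

theorem D_sub_ae {m : ℕ} {q : ℝ} {f g : I → ℝ} (hf : f ∈ W m q) (hg : g ∈ W m q) :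
    D m (f - g) =ᵐ[leb] D m f - D m g := by
  rw [sub_eq_add_neg, ← neg_one_smul ℝ g]
  filter_upwards [D_add_ae hf ((W m q).smul_mem (-1) hg)] with t ht
  rw [ht, D_smul]
  simp [sub_eq_add_neg]

theorem integrable_mul_of_conj {p q : ℝ} (hpq : p.HolderConjugate q) {u v : ℝ → ℝ}
    (hu : MemLp u (ENNReal.ofReal p) leb) (hv : MemLp v (ENNReal.ofReal q) leb) :
    Integrable (fun t => u t * v t) leb := by
  have : ENNReal.HolderConjugate (ENNReal.ofReal p) (ENNReal.ofReal q) := hpq.ennrealOfReal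
  exact hu.integrable_mul hv

theorem integrable_abs_rpow {q : ℝ} (hq : 0 < q) {u : ℝ → ℝ}
    (hu : MemLp u (ENNReal.ofReal q) leb) : Integrable (fun t => |u t| ^ q) leb := by
  have := hu.integrable_norm_rpow (by simpa using hq) ENNReal.ofReal_ne_top
  simpa [ENNReal.toReal_ofReal hq.le] using this

/-- The monomials are dual to the initial values, and their `m`-th derivatives vanish. -/
theorem pairing_mono {m j : ℕ} (hj : j < m) (g : I → ℝ) : pairing m g (mono j) = D j g 0 := by
  have h : ∫ t, D m (mono j) t * D m g t ∂leb = 0 := by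
    refine integral_eq_zero_of_ae ?_
    filter_upwards [ae_leb_mem_Ioo] with t ht
    rw [D_mono_of_lt hj (Ioo_subset_Icc_self ht)]
    simp
  rw [pairing, h, add_zero, Finset.sum_eq_single j]
  · simp [D_mono_zero]
  · intro i _ hij
    simp [D_mono_zero, hij]
  · exact fun h => absurd (Finset.mem_range.2 hj) h

/-- The negative polar consists of the functions with vanishing initial values and `χ_x g^{(m)} ≤ 0`
almost everywhere. -/
theorem mem_negPolar_iff {K m : ℕ} (hm : 1 ≤ m) {p q : ℝ} (hpq : p.HolderConjugate q)
    {x : Fin K → ℝ} (hx : Monotone x) {g : I → ℝ} : g ∈ negPolar m p q x ↔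
      g ∈ W m q ∧ (∀ j < m, D j g 0 = 0) ∧ ∀ᵐ t ∂leb, chi x t * D m g t ≤ 0 := by
  refine and_congr_right fun hg => ⟨fun h => ⟨fun j hj => ?_, ?_⟩, fun ⟨h0, h1⟩ f hf => ?_⟩
  · have hz : ∀ᵐ t ∂leb, D m (mono j) t = 0 := by
      filter_upwards [ae_leb_mem_Ioo] with t ht
      exact D_mono_of_lt hj (Ioo_subset_Icc_self ht)
    -- Both `mono j` and its negative lie in the cone, so the pairing with `g` is at most `0` and at
    -- least `0`.
    have h1 := h (mono j) ((mem_V_iff hx).2 ⟨mono_mem m p j, hz.mono fun t ht => by simp [ht]⟩)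
    have h2 := h ((-1 : ℝ) • mono j) ((mem_V_iff hx).2
      ⟨(W m p).smul_mem _ (mono_mem m p j), hz.mono fun t ht => by rw [D_smul, Pi.smul_apply, ht]; simp⟩)
    have e : pairing m g ((-1 : ℝ) • mono j) = -pairing m g (mono j) := by
      simp only [pairing, D_smul, Pi.smul_apply, smul_eq_mul, one_mul, mul_neg, neg_mul,
        integral_neg, Finset.sum_neg_distrib, neg_add]
    rw [e] at h2
    rw [pairing_mono hj] at h1 h2
    linarith
  -- A measurable representative is needed for the set in `u` to be measurable.
  · let v := hg.2.aestronglyMeasurable.mk (D m g)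
    have hv : D m g =ᵐ[leb] v := hg.2.aestronglyMeasurable.ae_eq_mk
    have hvm : Measurable v := hg.2.aestronglyMeasurable.stronglyMeasurable_mk.measurable
    -- The test derivative lives where the claimed inequality fails. Its pairing with `g` is the
    -- integral of the positive part of `χ_x g^{(m)}`, which must therefore vanish.
    let u : ℝ → ℝ := {t | 0 < chi x t * v t}.indicator (chi x)
    have hum : Measurable u := (measurable_chi x).indicator
      (measurableSet_lt measurable_const ((measurable_chi x).mul hvm))
    have hu : MemLp u (ENNReal.ofReal p) leb := by
      refine MemLp.of_bound hum.aestronglyMeasurable 1 ?_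
      filter_upwards [ae_leb_not_node x] with t ht
      refine (norm_indicator_le_norm_self _ _).trans ?_
      rcases chi_eq_or ht with h | h <;> simp [h]
    have hi := integrable_of_memLp hpq.lt.le hu
    have hD := D_lift_ae hm hi
    have huV : lift m u ∈ V m p x := by
      refine (mem_V_iff hx).2 ⟨lift_mem hm hpq.lt.le hu, ?_⟩
      filter_upwards [hD] with t ht
      rw [ht]
      by_cases h' : 0 < chi x t * v t
      · rw [show u t = chi x t from indicator_of_mem (s := {t | 0 < chi x t * v t}) h' _]
        exact mul_self_nonneg _
      · rw [show u t = 0 from indicator_of_notMem (s := {t | 0 < chi x t * v t}) h' _, mul_zero]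
    have hp := h _ huV
    have e : pairing m g (lift m u) = ∫ t, u t * D m g t ∂leb := by
      rw [pairing, Finset.sum_eq_zero fun j hj => by
        rw [D_lift_zero (Finset.mem_range.1 hj) hi, mul_zero], zero_add]
      refine integral_congr_ae ?_
      filter_upwards [hD] with t ht
      rw [ht]
    rw [e] at hp
    have hnn : 0 ≤ᵐ[leb] fun t => u t * D m g t := by
      filter_upwards [hv] with t ht
      rw [ht]
      by_cases h' : 0 < chi x t * v t
      · rw [show u t = chi x t from indicator_of_mem (s := {t | 0 < chi x t * v t}) h' _]
        exact h'.le
      · rw [show u t = 0 from indicator_of_notMem (s := {t | 0 < chi x t * v t}) h' _, zero_mul]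
        exact le_rfl
    have hzero := (integral_eq_zero_iff_of_nonneg_ae hnn
      (integrable_mul_of_conj hpq hu hg.2)).1 (le_antisymm hp (integral_nonneg_of_ae hnn))
    filter_upwards [hv, hzero] with t ht h1
    by_contra! hc
    have h' : 0 < chi x t * v t := ht ▸ hc
    rw [Pi.zero_apply,
      show u t = chi x t from indicator_of_mem (s := {t | 0 < chi x t * v t}) h' _] at h1
    exact hc.ne' h1
  · rw [pairing, Finset.sum_eq_zero fun j hj => by rw [h0 j (Finset.mem_range.1 hj), zero_mul],
      zero_add]
    refine integral_nonpos_of_ae ?_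
    filter_upwards [h1, ((mem_V_iff hx).1 hf).2, ae_leb_not_node x] with t h1 h2 h3
    show D m f t * D m g t ≤ 0
    rcases chi_eq_or h3 with h | h <;> rw [h] at h1 h2 <;> nlinarith

/-! ### The pointwise minimization and the dual projection -/

/-- The part of `v` whose sign agrees with `χ_x`. -/
def signPart {K : ℕ} (x : Fin K → ℝ) (v : ℝ → ℝ) (t : ℝ) : ℝ :=
  if 0 ≤ chi x t * v t then v t else 0

theorem abs_signPart_le {K : ℕ} (x : Fin K → ℝ) (v : ℝ → ℝ) (t : ℝ) :
    |signPart x v t| ≤ |v t| := by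
  rw [signPart]
  split_ifs
  · exact le_rfl
  · simp

theorem signPart_congr {K : ℕ} {x : Fin K → ℝ} {v w : ℝ → ℝ} {t : ℝ} (h : v t = w t) :
    signPart x v t = signPart x w t := by
  rw [signPart, signPart, h]

theorem memLp_signPart {K : ℕ} (x : Fin K → ℝ) {P : ENNReal} {v : ℝ → ℝ} (hv : MemLp v P leb) :
    MemLp (signPart x v) P leb := by
  refine hv.mono ?_ (ae_of_all _ (abs_signPart_le x v))
  let w := hv.aestronglyMeasurable.mk v
  have hw : Measurable w := hv.aestronglyMeasurable.stronglyMeasurable_mk.measurable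
  have hm : Measurable (signPart x w) := Measurable.ite
    (measurableSet_le measurable_const ((measurable_chi x).mul hw)) hw measurable_const
  exact hm.aestronglyMeasurable.congr
    (hv.aestronglyMeasurable.ae_eq_mk.mono fun t ht => (signPart_congr ht).symm)

theorem chi_mul_sub_signPart_nonpos {K : ℕ} (x : Fin K → ℝ) (v : ℝ → ℝ) (t : ℝ) :
    chi x t * (v t - signPart x v t) ≤ 0 := by
  rw [signPart]
  split_ifs with h
  · simp
  · simpa using (not_le.1 h).le

/-- Pointwise optimality: if `v` has the sign of `χ_x`, then `w` lies on the other side of `0` and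
cannot come closer than `0` does. Nodes are excluded because `χ_x = 0` there leaves `w`
unrestricted. -/
theorem abs_signPart_le_abs_sub {K : ℕ} {x : Fin K → ℝ} {v : ℝ → ℝ} {t w : ℝ}
    (hw : chi x t * w ≤ 0) (ht : ∀ k, x k ≠ t) : |signPart x v t| ≤ |v t - w| := by
  rw [signPart]
  split_ifs with h
  · rcases chi_eq_or ht with e | e <;> rw [e] at h hw
    · rw [abs_of_nonneg (by linarith), abs_of_nonneg (by linarith)]
      linarith
    · rw [abs_of_nonpos (by linarith), abs_of_nonpos (by linarith)]
      linarith
  · simp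

/-- The equality case of the pointwise bound; it is the source of uniqueness. -/
theorem sub_eq_signPart {K : ℕ} {x : Fin K → ℝ} {v : ℝ → ℝ} {t w : ℝ}
    (hw : chi x t * w ≤ 0) (ht : ∀ k, x k ≠ t) (h : |signPart x v t| = |v t - w|) :
    v t - w = signPart x v t := by
  rw [signPart] at h ⊢
  split_ifs at h ⊢ with h0
  · rcases chi_eq_or ht with e | e <;> rw [e] at h0 hw
    · rwa [abs_of_nonneg (by linarith), abs_of_nonneg (by linarith), eq_comm] at h
    · rw [abs_of_nonpos (by linarith), abs_of_nonpos (by linarith)] at h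
      linarith
  · rw [abs_zero, eq_comm, abs_eq_zero] at h
    exact h

section Projection

variable {K m : ℕ} {p q : ℝ} {x : Fin K → ℝ} {g : I → ℝ}

theorem D_zero_of_mem_feasible (hm : 1 ≤ m) (hpq : p.HolderConjugate q) (hx : Monotone x) {g' : I → ℝ} (h : g' ∈ feasible m p q x g) :
    ∀ j < m, D j g 0 = 0 := fun j hj => by
  rw [← h.2 j hj, ((mem_negPolar_iff hm hpq hx).1 h.1).2.1 j hj]

theorem lift_signPart_mem (hm : 1 ≤ m) (hpq : p.HolderConjugate q) (hg : g ∈ W m q) : lift m (signPart x (D m g)) ∈ W m q :=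
  lift_mem hm hpq.symm.lt.le (memLp_signPart x hg.2)

theorem D_lift_signPart_ae (hm : 1 ≤ m) (hpq : p.HolderConjugate q) (hg : g ∈ W m q) :
    D m (lift m (signPart x (D m g))) =ᵐ[leb] signPart x (D m g) :=
  D_lift_ae hm (integrable_of_memLp hpq.symm.lt.le (memLp_signPart x hg.2))

/-- The explicit minimizer: its `m`-th derivative is the part of `g^{(m)}` with the wrong sign. -/
theorem sub_lift_signPart_mem_feasible (hm : 1 ≤ m) (hpq : p.HolderConjugate q) (hx : Monotone x) (hg : g ∈ W m q) (h0 : ∀ j < m, D j g 0 = 0) :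
    g - lift m (signPart x (D m g)) ∈ feasible m p q x g := by
  have hl := lift_signPart_mem (x := x) hm hpq hg
  have hz : ∀ j < m, D j (g - lift m (signPart x (D m g))) 0 = 0 := fun j hj => by
    rw [D_sub_of_mem hj hg hl, h0 j hj, D_lift_zero hj
      (integrable_of_memLp hpq.symm.lt.le (memLp_signPart x hg.2)), sub_zero]
  refine ⟨(mem_negPolar_iff hm hpq hx).2 ⟨(W m q).sub_mem hg hl, hz, ?_⟩,
    fun j hj => by rw [hz j hj, h0 j hj]⟩
  filter_upwards [D_sub_ae hg hl, D_lift_signPart_ae hm hpq hg] with t h1 h2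
  rw [h1, Pi.sub_apply, h2]
  exact chi_mul_sub_signPart_nonpos x _ t

theorem integral_abs_sub_signPart (hm : 1 ≤ m) (hpq : p.HolderConjugate q) (hg : g ∈ W m q) :
    ∫ t, |D m g t - D m (g - lift m (signPart x (D m g))) t| ^ q ∂leb =
      ∫ t, |signPart x (D m g) t| ^ q ∂leb := by
  refine integral_congr_ae ?_
  filter_upwards [D_sub_ae hg (lift_signPart_mem hm hpq hg),
    D_lift_signPart_ae hm hpq hg] with t h1 h2
  rw [h1, Pi.sub_apply, h2, sub_sub_cancel]

theorem abs_signPart_rpow_le_ae (hm : 1 ≤ m) (hpq : p.HolderConjugate q) (hx : Monotone x) {g' : I → ℝ} (h : g' ∈ feasible m p q x g) :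
    (fun t => |signPart x (D m g) t| ^ q) ≤ᵐ[leb] fun t => |D m g t - D m g' t| ^ q := by
  filter_upwards [((mem_negPolar_iff hm hpq hx).1 h.1).2.2, ae_leb_not_node x] with t h1 h2
  exact Real.rpow_le_rpow (abs_nonneg _) (abs_signPart_le_abs_sub h1 h2) hpq.symm.pos.le

theorem integrable_abs_signPart (hpq : p.HolderConjugate q) (hg : g ∈ W m q) : Integrable (fun t => |signPart x (D m g) t| ^ q) leb :=
  integrable_abs_rpow hpq.symm.pos (memLp_signPart x hg.2)

theorem integrable_abs_sub (hpq : p.HolderConjugate q) (hg : g ∈ W m q) {g' : I → ℝ} (h : g' ∈ feasible m p q x g) :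
    Integrable (fun t => |D m g t - D m g' t| ^ q) leb :=
  integrable_abs_rpow hpq.symm.pos (hg.2.sub h.1.1.2)

theorem integral_abs_signPart_le (hm : 1 ≤ m) (hpq : p.HolderConjugate q) (hx : Monotone x) (hg : g ∈ W m q) {g' : I → ℝ} (h : g' ∈ feasible m p q x g) :
    ∫ t, |signPart x (D m g) t| ^ q ∂leb ≤ ∫ t, |D m g t - D m g' t| ^ q ∂leb :=
  integral_mono_ae (integrable_abs_signPart hpq hg) (integrable_abs_sub hpq hg h)
    (abs_signPart_rpow_le_ae hm hpq hx h)

theorem isDualProjection_iff (hm : 1 ≤ m) (hpq : p.HolderConjugate q) (hx : Monotone x) (hg : g ∈ W m q) {h : I → ℝ} : IsDualProjection m p q x g h ↔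
    (∀ j < m, D j g 0 = 0) ∧ h = lift m (signPart x (D m g)) := by
  have hl := lift_signPart_mem (x := x) hm hpq hg
  constructor
  · rintro ⟨g', hg', rfl, hmin⟩
    have h0 := D_zero_of_mem_feasible hm hpq hx hg'
    refine ⟨h0, ?_⟩
    have hpol := (mem_negPolar_iff hm hpq hx).1 hg'.1
    have hle := hmin (sub_lift_signPart_mem_feasible hm hpq hx hg h0)
    simp only [mem_ofPred_eq, integral_abs_sub_signPart hm hpq hg] at hle
    -- An almost everywhere inequality between integrable functions with equal integrals is an
    -- almost everywhere equality.
    have heq := (integral_eq_iff_of_ae_le (integrable_abs_signPart hpq hg)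
      (integrable_abs_sub hpq hg hg') (abs_signPart_rpow_le_ae hm hpq hx hg')).1
      (le_antisymm (integral_abs_signPart_le hm hpq hx hg hg') hle)
    have hd : D m (g - g') =ᵐ[leb] signPart x (D m g) := by
      filter_upwards [heq, D_sub_ae hg hpol.1, hpol.2.2, ae_leb_not_node x] with t h1 h2 h3 h4
      rw [h2]
      exact sub_eq_signPart h3 h4
        ((Real.rpow_left_inj (abs_nonneg _) (abs_nonneg _) hpq.symm.pos.ne').1 h1)
    rw [← sub_eq_zero]
    have hsub := (W m q).sub_mem hg hpol.1
    refine eq_zero_of_D hm ((W m q).sub_mem hsub hl) (fun j hj => ?_) ?_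
    · rw [D_sub_of_mem hj hsub hl, D_sub_of_mem hj hg hpol.1, h0 j hj, hpol.2.1 j hj, D_lift_zero hj
        (integrable_of_memLp hpq.symm.lt.le (memLp_signPart x hg.2))]
      simp
    · filter_upwards [D_sub_ae hsub hl, hd, D_lift_signPart_ae hm hpq hg] with t h1 h2 h3
      rw [h1, Pi.sub_apply, h2, h3, sub_self]
      rfl
  · rintro ⟨h0, rfl⟩
    refine ⟨_, sub_lift_signPart_mem_feasible hm hpq hx hg h0, (sub_sub_cancel _ _).symm,
      fun g' hg' => ?_⟩
    simp only [mem_ofPred_eq, integral_abs_sub_signPart hm hpq hg]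
    exact integral_abs_signPart_le hm hpq hx hg hg'

theorem dualEnergy_eq (hm : 1 ≤ m) (hpq : p.HolderConjugate q) (hx : Monotone x) (hg : g ∈ W m q) (h0 : ∀ j < m, D j g 0 = 0) : dualEnergy m p q x g =
    ((∫ t, |signPart x (D m g) t| ^ q ∂leb : ℝ) : EReal) := by
  refine le_antisymm ?_ (le_iInf₂ fun g' hg' =>
    EReal.coe_le_coe_iff.2 (integral_abs_signPart_le hm hpq hx hg hg'))
  rw [← integral_abs_sub_signPart hm hpq hg]
  exact iInf₂_le _ (sub_lift_signPart_mem_feasible hm hpq hx hg h0)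

theorem dualEnergy_eq_top (hm : 1 ≤ m) (hpq : p.HolderConjugate q) (hx : Monotone x) (h0 : ¬ ∀ j < m, D j g 0 = 0) : dualEnergy m p q x g = ⊤ := by
  rw [dualEnergy, iInf₂_eq_top]
  exact fun g' hg' => absurd (D_zero_of_mem_feasible hm hpq hx hg') h0

end Projection

/-! ### Convexity of the energy -/

/-- Off the nodes `|signPart x v t| = max 0 (χ_x(t) v(t))`, a positive part of a linear expression
in `v`, hence sublinear. -/
theorem abs_signPart_add_le {K : ℕ} {x : Fin K → ℝ} {t : ℝ} (ht : ∀ k, x k ≠ t) (v w : ℝ → ℝ)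
    {a c : ℝ} (ha : 0 ≤ a) (hc : 0 ≤ c) :
    |signPart x (a • v + c • w) t| ≤ a * |signPart x v t| + c * |signPart x w t| := by
  have key : ∀ v : ℝ → ℝ, |signPart x v t| = max 0 (chi x t * v t) := fun v => by
    rw [signPart]
    split_ifs with h
    · rw [max_eq_right h]
      rcases chi_eq_or ht with e | e <;> rw [e] at h ⊢
      · rw [abs_of_nonneg (by linarith), one_mul]
      · rw [abs_of_nonpos (by linarith), neg_one_mul]
    · rw [max_eq_left (not_le.1 h).le, abs_zero]
  simp only [key, Pi.add_apply, Pi.smul_apply, smul_eq_mul]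
  have h1 := mul_le_mul_of_nonneg_left (le_max_right 0 (chi x t * v t)) ha
  have h2 := mul_le_mul_of_nonneg_left (le_max_right 0 (chi x t * w t)) hc
  refine max_le ?_ ?_
  · exact add_nonneg (mul_nonneg ha (le_max_left _ _)) (mul_nonneg hc (le_max_left _ _))
  · linarith

theorem integral_abs_signPart_add_le {K : ℕ} (x : Fin K → ℝ) {q : ℝ} (hq : 1 ≤ q) {v w : ℝ → ℝ}
    (hv : MemLp v (ENNReal.ofReal q) leb) (hw : MemLp w (ENNReal.ofReal q) leb) {a c : ℝ}
    (ha : 0 ≤ a) (hc : 0 ≤ c) (hac : a + c = 1) :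
    ∫ t, |signPart x (a • v + c • w) t| ^ q ∂leb ≤
      a * ∫ t, |signPart x v t| ^ q ∂leb + c * ∫ t, |signPart x w t| ^ q ∂leb := by
  have hq0 : 0 < q := by linarith
  have iv := integrable_abs_rpow hq0 (memLp_signPart x hv)
  have iw := integrable_abs_rpow hq0 (memLp_signPart x hw)
  have ivw := integrable_abs_rpow hq0
    (memLp_signPart x ((hv.const_smul a).add (hw.const_smul c)))
  rw [← integral_const_mul, ← integral_const_mul,
    ← integral_add (iv.const_mul a) (iw.const_mul c)]
  refine integral_mono_ae ivw ((iv.const_mul a).add (iw.const_mul c)) ?_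
  filter_upwards [ae_leb_not_node x] with t ht
  refine (Real.rpow_le_rpow (abs_nonneg _) (abs_signPart_add_le ht v w ha hc) hq0.le).trans ?_
  exact (convexOn_rpow hq).2 (mem_Ici.2 (abs_nonneg _)) (mem_Ici.2 (abs_nonneg _)) ha hc hac

/-! ### Linear combinations of representers -/

section Representers

variable {m N : ℕ} {q : ℝ} {b : Fin N → I → ℝ}

theorem B_eq_sum (b : Fin N → I → ℝ) (α : Fin N → ℝ) : B b α = ∑ i, α i • b i := by
  funext t
  simp [B]

theorem B_mem (hb : ∀ i, b i ∈ W m q) (α : Fin N → ℝ) : B b α ∈ W m q := by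
  rw [B_eq_sum]
  exact (W m q).sum_mem fun i _ => (W m q).smul_mem _ (hb i)

theorem D_B_zero (hb : ∀ i, b i ∈ W m q) (α : Fin N → ℝ) {j : ℕ} (hj : j < m) :
    D j (B b α) 0 = ∑ i, α i * D j (b i) 0 := by
  rw [B_eq_sum]
  induction (Finset.univ : Finset (Fin N)) using Finset.induction_on with
  | empty => simpa using congrFun (D_smul j 0 (0 : I → ℝ)) 0
  | insert i s hi ih =>
    rw [Finset.sum_insert hi, Finset.sum_insert hi, ← ih, D_add_of_contDiffOn
      (((W m q).smul_mem (α i) (hb i)).1 j hj).1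
      (((W m q).sum_mem fun i (_ : i ∈ s) => (W m q).smul_mem (α i) (hb i)).1 j hj).1
      (left_mem_Icc.2 zero_le_one), Pi.add_apply, D_smul]
    rfl

/-- In contrast to orders `< m`, the top derivative is additive only where the derivatives of order
`m - 1` are differentiable. -/
theorem D_B_ae (hb : ∀ i, b i ∈ W m q) (α : Fin N → ℝ) :
    D m (B b α) =ᵐ[leb] fun t => ∑ i, α i * D m (b i) t := by
  rw [B_eq_sum]
  induction (Finset.univ : Finset (Fin N)) using Finset.induction_on with
  | empty =>
    refine ae_of_all _ fun t => ?_
    simpa using congrFun (D_smul m 0 (0 : I → ℝ)) t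
  | insert i s hi ih =>
    rw [Finset.sum_insert hi]
    filter_upwards [ih, D_add_ae ((W m q).smul_mem (α i) (hb i))
      ((W m q).sum_mem fun i (_ : i ∈ s) => (W m q).smul_mem (α i) (hb i))] with t h1 h2
    rw [h2, Pi.add_apply, h1, D_smul, Finset.sum_insert hi]
    rfl

theorem explicitDeriv_eq_signPart {K : ℕ} (x : Fin K → ℝ) (α : Fin N → ℝ) :
    explicitDeriv m x b α = signPart x (fun t => ∑ i, α i * D m (b i) t) := rfl

theorem signPart_D_B_ae {K : ℕ} (x : Fin K → ℝ) (hb : ∀ i, b i ∈ W m q) (α : Fin N → ℝ) :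
    signPart x (D m (B b α)) =ᵐ[leb] explicitDeriv m x b α := by
  filter_upwards [D_B_ae hb α] with t ht
  rw [explicitDeriv_eq_signPart]
  exact signPart_congr ht

theorem memLp_sum_D (hb : ∀ i, b i ∈ W m q) (α : Fin N → ℝ) :
    MemLp (fun t => ∑ i, α i * D m (b i) t) (ENNReal.ofReal q) leb :=
  (memLp_congr_ae (D_B_ae hb α)).1 (B_mem hb α).2

end Representers

/-! ### Fenchel conjugates and extended-real sums -/

theorem fenchelConj_le_iff {ρ : ℝ → ℝ} {a c : ℝ} :
    fenchelConj ρ a ≤ (c : EReal) ↔ ∀ z, a * z - ρ z ≤ c := by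
  simp only [fenchelConj, iSup_le_iff, EReal.coe_le_coe_iff]

theorem fenchelConj_ne_bot (ρ : ℝ → ℝ) (a : ℝ) : fenchelConj ρ a ≠ ⊥ := fun h => by
  have := le_iSup (fun z : ℝ => ((a * z - ρ z : ℝ) : EReal)) 0
  rw [← fenchelConj, h, le_bot_iff] at this
  exact EReal.coe_ne_bot _ this

theorem ereal_coe_sum {ι : Type*} (s : Finset ι) (f : ι → ℝ) :
    ((∑ i ∈ s, f i : ℝ) : EReal) = ∑ i ∈ s, (f i : EReal) :=
  map_sum (⟨⟨Real.toEReal, EReal.coe_zero⟩, EReal.coe_add⟩ : ℝ →+ EReal) f s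

theorem ereal_sum_ne_bot {ι : Type*} (s : Finset ι) {f : ι → EReal} (h : ∀ i, f i ≠ ⊥) :
    ∑ i ∈ s, f i ≠ ⊥ := by
  classical
  induction s using Finset.induction_on with
  | empty => simp
  | insert i s hi ih =>
    rw [Finset.sum_insert hi]
    exact EReal.add_ne_bot_iff.2 ⟨h i, ih⟩

theorem ereal_ne_top_of_sum_ne_top {ι : Type*} [DecidableEq ι] {s : Finset ι} {f : ι → EReal}
    (h : ∀ i, f i ≠ ⊥) (hs : ∑ i ∈ s, f i ≠ ⊤) {i : ι} (hi : i ∈ s) : f i ≠ ⊤ := fun ht => by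
  rw [← Finset.add_sum_erase s f hi, ht, EReal.top_add_of_ne_bot (ereal_sum_ne_bot _ h)] at hs
  exact hs rfl

theorem ereal_sub_coe_ne_bot {a : EReal} (ha : a ≠ ⊥) (c : ℝ) : a - (c : EReal) ≠ ⊥ := by
  rw [sub_eq_add_neg]
  exact EReal.add_ne_bot_iff.2 ⟨ha, by rw [← EReal.coe_neg]; exact EReal.coe_ne_bot _⟩

theorem sum_fenchelConj_ne_bot {N : ℕ} (ρ : Fin N → ℝ → ℝ) (y α : Fin N → ℝ) :
    ∑ i, (fenchelConj (ρ i) (α i) - ((α i * y i : ℝ) : EReal)) ≠ ⊥ :=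
  ereal_sum_ne_bot _ fun _ => ereal_sub_coe_ne_bot (fenchelConj_ne_bot _ _) _

/-- The real numbers `c i` bound the conjugates from above and remove extended-real arithmetic. A
finite total forces every conjugate to be finite, since no summand is `⊥`; the conjugates themselves
then serve as `c`. -/
theorem coe_add_sum_fenchelConj_le_iff {N : ℕ} (ρ : Fin N → ℝ → ℝ) (y α : Fin N → ℝ) (e r : ℝ) :
    (e : EReal) + ∑ i, (fenchelConj (ρ i) (α i) - ((α i * y i : ℝ) : EReal)) ≤ (r : EReal) ↔
      ∃ c : Fin N → ℝ, (∀ i z, α i * z - ρ i z ≤ c i) ∧ e + ∑ i, (c i - α i * y i) ≤ r := by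
  constructor
  · intro h
    have hS : ∑ i, (fenchelConj (ρ i) (α i) - ((α i * y i : ℝ) : EReal)) ≠ ⊤ := fun ht => by
      rw [ht, EReal.coe_add_top, top_le_iff] at h
      exact EReal.coe_ne_top _ h
    have hi : ∀ i, fenchelConj (ρ i) (α i) ≠ ⊤ := fun i ht =>
      ereal_ne_top_of_sum_ne_top (fun i => ereal_sub_coe_ne_bot (fenchelConj_ne_bot (ρ i) (α i)) _)
        hS (Finset.mem_univ i) (by rw [ht, EReal.top_sub_coe])
    have hc : ∀ i, ((fenchelConj (ρ i) (α i)).toReal : EReal) = fenchelConj (ρ i) (α i) :=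
      fun i => EReal.coe_toReal (hi i) (fenchelConj_ne_bot _ _)
    refine ⟨fun i => (fenchelConj (ρ i) (α i)).toReal,
      fun i => fenchelConj_le_iff.1 (hc i).ge, ?_⟩
    rw [← EReal.coe_le_coe_iff, EReal.coe_add, ereal_coe_sum]
    simpa only [EReal.coe_sub, hc] using h
  · rintro ⟨c, hc, h⟩
    refine le_trans ?_ (EReal.coe_le_coe_iff.2 h)
    rw [EReal.coe_add, ereal_coe_sum]
    refine add_le_add le_rfl (Finset.sum_le_sum fun i _ => ?_)
    rw [EReal.coe_sub]
    exact EReal.sub_le_sub (fenchelConj_le_iff.2 (hc i)) le_rfl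

/-! ### The dual functional and its epigraph -/

section DualFunctional

variable {K m N : ℕ} {p q lam : ℝ} {x : Fin K → ℝ} {b : Fin N → I → ℝ}

theorem initial_B_iff (hb : ∀ i, b i ∈ W m q) (α : Fin N → ℝ) :
    (∀ j < m, D j (B b α) 0 = 0) ↔ ∀ j < m, ∑ i, α i * D j (b i) 0 = 0 :=
  forall₂_congr fun j hj => by rw [D_B_zero hb α hj]

theorem dualEnergy_B (hm : 1 ≤ m) (hpq : p.HolderConjugate q) (hx : Monotone x)
    (hb : ∀ i, b i ∈ W m q) {α : Fin N → ℝ} (h : ∀ j < m, ∑ i, α i * D j (b i) 0 = 0) :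
    dualEnergy m p q x (B b α) = ((∫ t, |explicitDeriv m x b α t| ^ q ∂leb : ℝ) : EReal) := by
  rw [dualEnergy_eq hm hpq hx (B_mem hb α) ((initial_B_iff hb α).2 h)]
  congr 1
  refine integral_congr_ae ?_
  filter_upwards [signPart_D_B_ae x hb α] with t ht
  rw [ht]

theorem dualFunctional_eq (hm : 1 ≤ m) (hpq : p.HolderConjugate q) (hx : Monotone x)
    (hb : ∀ i, b i ∈ W m q) (ρ : Fin N → ℝ → ℝ) (y : Fin N → ℝ) {α : Fin N → ℝ}
    (h : ∀ j < m, ∑ i, α i * D j (b i) 0 = 0) : dualFunctional m p q lam x b ρ y α =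
      ((lam ^ (1 - q) / q * ∫ t, |explicitDeriv m x b α t| ^ q ∂leb : ℝ) : EReal) +
        ∑ i, (fenchelConj (ρ i) (α i) - ((α i * y i : ℝ) : EReal)) := by
  rw [dualFunctional, dualEnergy_B hm hpq hx hb h, ← EReal.coe_mul]

theorem dualFunctional_eq_top (hm : 1 ≤ m) (hpq : p.HolderConjugate q) (hx : Monotone x)
    (hb : ∀ i, b i ∈ W m q) (hlam : 0 < lam) (ρ : Fin N → ℝ → ℝ) (y : Fin N → ℝ) {α : Fin N → ℝ}
    (h : ¬ ∀ j < m, ∑ i, α i * D j (b i) 0 = 0) : dualFunctional m p q lam x b ρ y α = ⊤ := by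
  -- Two conventions of `EReal` matter: `0 * ⊤ = 0`, so the factor must be positive, and `⊤ + ⊥ =
  -- ⊥`, so the sum must not be `⊥`.
  rw [dualFunctional, dualEnergy_eq_top hm hpq hx ((initial_B_iff hb α).not.2 h),
    EReal.coe_mul_top_of_pos (div_pos (Real.rpow_pos_of_pos hlam _) hpq.symm.pos),
    EReal.top_add_of_ne_bot (sum_fenchelConj_ne_bot ρ y α)]

theorem dualFunctional_ne_bot (hm : 1 ≤ m) (hpq : p.HolderConjugate q) (hx : Monotone x)
    (hb : ∀ i, b i ∈ W m q) (hlam : 0 < lam) (ρ : Fin N → ℝ → ℝ) (y α : Fin N → ℝ) :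
    dualFunctional m p q lam x b ρ y α ≠ ⊥ := by
  by_cases h : ∀ j < m, ∑ i, α i * D j (b i) 0 = 0
  · rw [dualFunctional_eq hm hpq hx hb ρ y h]
    exact EReal.add_ne_bot_iff.2 ⟨EReal.coe_ne_bot _, sum_fenchelConj_ne_bot ρ y α⟩
  · rw [dualFunctional_eq_top hm hpq hx hb hlam ρ y h]
    exact top_ne_bot

theorem dualFunctional_le_iff (hm : 1 ≤ m) (hpq : p.HolderConjugate q) (hx : Monotone x)
    (hb : ∀ i, b i ∈ W m q) (hlam : 0 < lam) (ρ : Fin N → ℝ → ℝ) (y α : Fin N → ℝ) (r : ℝ) :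
    dualFunctional m p q lam x b ρ y α ≤ (r : EReal) ↔
      (∀ j < m, ∑ i, α i * D j (b i) 0 = 0) ∧
      ∃ c : Fin N → ℝ, (∀ i z, α i * z - ρ i z ≤ c i) ∧
        lam ^ (1 - q) / q * ∫ t, |explicitDeriv m x b α t| ^ q ∂leb +
          ∑ i, (c i - α i * y i) ≤ r := by
  by_cases h : ∀ j < m, ∑ i, α i * D j (b i) 0 = 0
  · rw [dualFunctional_eq hm hpq hx hb ρ y h, coe_add_sum_fenchelConj_le_iff]
    exact (and_iff_right h).symm
  · rw [dualFunctional_eq_top hm hpq hx hb hlam ρ y h, top_le_iff]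
    exact iff_of_false (EReal.coe_ne_top r) fun h' => h h'.1

theorem convex_epigraph_dualFunctional (hm : 1 ≤ m) (hpq : p.HolderConjugate q)
    (hx : Monotone x) (hb : ∀ i, b i ∈ W m q) (hlam : 0 < lam) (ρ : Fin N → ℝ → ℝ)
    (y : Fin N → ℝ) :
    Convex ℝ {z : (Fin N → ℝ) × ℝ | dualFunctional m p q lam x b ρ y z.1 ≤ (z.2 : EReal)} := by
  rintro ⟨α, r⟩ h₁ ⟨β, s⟩ h₂ a d ha hd had
  simp only [mem_ofPred_eq, dualFunctional_le_iff hm hpq hx hb hlam] at h₁ h₂ ⊢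
  obtain ⟨hα, c, hc, hr⟩ := h₁
  obtain ⟨hβ, e, he, hs⟩ := h₂
  have hsum : ∀ w : Fin N → ℝ, ∑ i, (a • α + d • β) i * w i =
      a * ∑ i, α i * w i + d * ∑ i, β i * w i := fun w => by
    rw [Finset.mul_sum, Finset.mul_sum, ← Finset.sum_add_distrib]
    exact Finset.sum_congr rfl fun i _ => by
      simp only [Pi.add_apply, Pi.smul_apply, smul_eq_mul]
      ring
  -- For fixed `z`, the bound `α i * z - ρ i z ≤ c i` is affine in `(α, c)`, so the same convex
  -- combination of the bounds is admissible.
  refine ⟨fun j hj => ?_, fun i => a * c i + d * e i, fun i z => ?_, ?_⟩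
  · simp only [Prod.fst_add, Prod.smul_fst]
    rw [hsum, hα j hj, hβ j hj]
    simp
  · have h1 := mul_le_mul_of_nonneg_left (hc i z) ha
    have h2 := mul_le_mul_of_nonneg_left (he i z) hd
    have h3 : ρ i z = a * ρ i z + d * ρ i z := by rw [← add_mul, had, one_mul]
    simp only [Prod.fst_add, Prod.smul_fst, Pi.add_apply, Pi.smul_apply, smul_eq_mul]
    linarith
  · have hE := integral_abs_signPart_add_le x hpq.symm.lt.le (memLp_sum_D hb α) (memLp_sum_D hb β)
      ha hd had
    have hcomb : a • (fun t => ∑ i, α i * D m (b i) t) + d • (fun t => ∑ i, β i * D m (b i) t) =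
        fun t => ∑ i, (a • α + d • β) i * D m (b i) t := funext fun t => (hsum _).symm
    rw [hcomb] at hE
    simp only [← explicitDeriv_eq_signPart] at hE
    have hk : 0 ≤ lam ^ (1 - q) / q := (div_pos (Real.rpow_pos_of_pos hlam _) hpq.symm.pos).le
    have hE' := mul_le_mul_of_nonneg_left hE hk
    have hlin : ∑ i, (a * c i + d * e i - (a • α + d • β) i * y i) =
        a * ∑ i, (c i - α i * y i) + d * ∑ i, (e i - β i * y i) := by
      rw [Finset.mul_sum, Finset.mul_sum, ← Finset.sum_add_distrib]
      exact Finset.sum_congr rfl fun i _ => by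
        simp only [Pi.add_apply, Pi.smul_apply, smul_eq_mul]
        ring
    have h1 := mul_le_mul_of_nonneg_left hr ha
    have h2 := mul_le_mul_of_nonneg_left hs hd
    simp only [Prod.fst_add, Prod.smul_fst, Prod.snd_add, Prod.smul_snd, smul_eq_mul]
    rw [hlin]
    linarith

end DualFunctional

end

end PiecewiseConvex

/-! ### Assembly of the theorem -/

theorem mainTheorem5 (m : ℕ) (hm : 1 ≤ m) (p q : ℝ) (hpq : p.HolderConjugate q)
    (K : ℕ) (x : Fin K → ℝ) (hx : Monotone x) (hx01 : ∀ k, x k ∈ Set.Icc (0 : ℝ) 1)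
    (N : ℕ) (L : Fin N → W m p →ₗ[ℝ] ℝ) (hL : ∀ i, IsBoundedFunctional (L i))
    (ρ : Fin N → ℝ → ℝ) (hρconv : ∀ i, StrictConvexOn ℝ Set.univ (ρ i))
    (hρcont : ∀ i, Continuous (ρ i)) (y : Fin N → ℝ) (lam : ℝ) (hlam : 0 < lam)
    (b : Fin N → unitInterval → ℝ) (hb : ∀ i, b i = representer hm (L i)) :
    -- the representers `b_i` belong to `W_{m,q}`
    (∀ i, b i ∈ W m q) ∧
    -- domain and uniqueness of the dual projection
    (∀ g ∈ W m q,
      ((∃ h, IsDualProjection m p q x g h) ↔ ∀ j < m, D j g 0 = 0) ∧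
      ((∀ j < m, D j g 0 = 0) → ∃! h, IsDualProjection m p q x g h)) ∧
    -- the dual projection is a local operator
    (∀ g₁ ∈ W m q, ∀ g₂ ∈ W m q, ∀ h₁ h₂, IsDualProjection m p q x g₁ h₁ →
      IsDualProjection m p q x g₂ h₂ → ∀ A : Set ℝ,
      (∀ᵐ t ∂leb, t ∈ A → D m g₁ t = D m g₂ t) →
      ∀ᵐ t ∂leb, t ∈ A → D m h₁ t = D m h₂ t) ∧
    -- the explicit formula for the dual projection of `Bα`
    (∀ α : Fin N → ℝ,
      ((∃ h, IsDualProjection m p q x (B b α) h) ↔ ∀ j < m, ∑ i, α i * D j (b i) 0 = 0) ∧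
      ∀ h, IsDualProjection m p q x (B b α) h →
        h ∈ W m q ∧ ∀ᵐ t ∂leb, D m h t = explicitDeriv m x b α t) ∧
    -- the minimization over the negative polar is solved explicitly
    (∀ α : Fin N → ℝ, (∀ j < m, ∑ i, α i * D j (b i) 0 = 0) →
      MeasureTheory.Integrable (fun t => |explicitDeriv m x b α t| ^ q) leb ∧
      dualEnergy m p q x (B b α) =
        ((∫ t, |explicitDeriv m x b α t| ^ q ∂leb : ℝ) : EReal)) ∧
    -- the dual problem is an explicit minimization over a linear subspace of `ℝ^N`
    (∀ α : Fin N → ℝ,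
      ((∀ j < m, ∑ i, α i * D j (b i) 0 = 0) → dualFunctional m p q lam x b ρ y α =
        ((lam ^ (1 - q) / q * ∫ t, |explicitDeriv m x b α t| ^ q ∂leb : ℝ) : EReal) +
          ∑ i, (fenchelConj (ρ i) (α i) - ((α i * y i : ℝ) : EReal))) ∧
      ((¬ ∀ j < m, ∑ i, α i * D j (b i) 0 = 0) → dualFunctional m p q lam x b ρ y α = ⊤)) ∧
    -- and this minimization is convex
    (∀ α, dualFunctional m p q lam x b ρ y α ≠ ⊥) ∧
    Convex ℝ {z : (Fin N → ℝ) × ℝ | dualFunctional m p q lam x b ρ y z.1 ≤ (z.2 : EReal)} := by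
  have hbW : ∀ i, b i ∈ W m q := fun i => hb i ▸ representer_mem hm hpq (hL i)
  have hiff : ∀ g ∈ W m q, ∀ h, IsDualProjection m p q x g h ↔
      (∀ j < m, D j g 0 = 0) ∧ h = lift m (signPart x (D m g)) := fun g hg h =>
    isDualProjection_iff hm hpq hx hg
  have hex : ∀ g ∈ W m q, (∃ h, IsDualProjection m p q x g h) ↔ ∀ j < m, D j g 0 = 0 :=
    fun g hg => ⟨fun ⟨h, hh⟩ => ((hiff g hg h).1 hh).1,
      fun h0 => ⟨_, (hiff g hg _).2 ⟨h0, rfl⟩⟩⟩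
  have hderiv : ∀ g ∈ W m q, ∀ h, IsDualProjection m p q x g h →
      D m h =ᵐ[leb] signPart x (D m g) := fun g hg h hh => by
    rw [((hiff g hg h).1 hh).2]
    exact D_lift_signPart_ae hm hpq hg
  refine ⟨hbW, fun g hg => ⟨hex g hg, fun h0 => ?_⟩, ?_, fun α => ⟨?_, fun h hh => ⟨?_, ?_⟩⟩,
    fun α h => ⟨?_, dualEnergy_B hm hpq hx hbW h⟩,
    fun α => ⟨dualFunctional_eq hm hpq hx hbW ρ y, dualFunctional_eq_top hm hpq hx hbW hlam ρ y⟩,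
    dualFunctional_ne_bot hm hpq hx hbW hlam ρ y,
    convex_epigraph_dualFunctional hm hpq hx hbW hlam ρ y⟩
  · exact ⟨_, (hiff g hg _).2 ⟨h0, rfl⟩, fun h hh => ((hiff g hg h).1 hh).2⟩
  · intro g₁ hg₁ g₂ hg₂ h₁ h₂ hh₁ hh₂ A hA
    filter_upwards [hderiv g₁ hg₁ h₁ hh₁, hderiv g₂ hg₂ h₂ hh₂, hA] with t e₁ e₂ hAt ht
    rw [e₁, e₂]
    exact signPart_congr (hAt ht)
  · exact (hex _ (B_mem hbW α)).trans (initial_B_iff hbW α)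
  · rw [((hiff _ (B_mem hbW α) h).1 hh).2]
    exact lift_signPart_mem hm hpq (B_mem hbW α)
  · exact (hderiv _ (B_mem hbW α) h hh).trans (signPart_D_B_ae x hbW α)
  · exact integrable_abs_rpow hpq.symm.pos (memLp_signPart x (memLp_sum_D hbW α))
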